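/- Let $m>0$ and let $L^2(\mu_m)$ be the space of square integrable complex functions on $\mathbb C$ with respect to $d\mu_m(z)=\frac1\pi e^{-m|z|^2}\,dA(z)$, $A$ being Lebesgue area measure. Let $\mathcal F_m$ be the Fock space of entire functions in $L^2(\mu_m)$. For $N\in\mathbb N=\{0,1,2,\dots\}$ let $F^{N,m}$ be the polyanalytic Fock space of order $N$, i.e. the kernel of $\bar\partial^N$ (in the sense of distributions on $\mathbb C$) in $L^2(\mu_m)$; it is a closed subspace, and $P_{F^{N,m}}$ denotes the orthogonal projection of $L^2(\mu_m)$ onto it. Let $g$ be an entire function such that $z^n g\in L^2(\mu_m)$ for all $n\in\mathbb N$, and for analytic polynomials $f$ put $$\tilde H^N_{\bar g}f=(I-P_{F^{N,m}})(\bar g f)\in L^2(\mu_m).$$ Then $\tilde H^N_{\bar g}$ extends to a bounded operator from $\mathcal F_m$ to $L^2(\mu_m)$ if and only if $g$ is a polynomial of degree at most $N$. Moreover, $\tilde H^N_{\bar g}$ extends to a compact operator from $\mathcal F_m$ to $L^2(\mu_m)$ if and only if $g$ is a polynomial of degree strictly smaller than $N$ (the zero polynomial has degree $-\infty$), and this holds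 if and only if $\tilde H^N_{\bar g}$ is the zero operator. In particular, for every $f\in\mathcal F_m$ the equation $\bar\partial^N u=f$ (in the sense of distributions) has a unique solution $u\in L^2(\mu_m)$ of minimal norm, and the solution operator $f\mapsto u$ from $\mathcal F_m$ to $L^2(\mu_m)$ is linear and bounded but not compact. -/

import Mathlib

open MeasureTheory Complex
open scoped ContDiff Polynomial ComplexConjugate

noncomputable section

namespace Fock

/-- The weighted Gaussian measure `dμ_m(z) = π⁻¹ exp(-m |z|²) dA(z)` on `ℂ`. -/
def μ (m : ℝ) : Measure ℂ :=
  (volume : Measure ℂ).withDensity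
    (fun z => ENNReal.ofReal (Real.exp (-m * ‖z‖ ^ 2) / Real.pi))

/-- The Hilbert space `L²(μ_m)`. -/
abbrev L2 (m : ℝ) : Type := Lp ℂ 2 (μ m)

/-- The Fock space `F_m`: the (classes of) entire functions in `L²(μ_m)`. -/
def fockSpace (m : ℝ) : Submodule ℂ (L2 m) where
  carrier := {f | ∃ F : ℂ → ℂ, Differentiable ℂ F ∧ f =ᵐ[μ m] F}
  add_mem' := by
    rintro a b ⟨F, hF, haF⟩ ⟨G, hG, hbG⟩
    exact ⟨F + G, hF.add hG, (Lp.coeFn_add a b).trans (haF.add hbG)⟩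
  zero_mem' := ⟨0, differentiable_const 0, Lp.coeFn_zero _ _ _⟩
  smul_mem' := by
    rintro c a ⟨F, hF, haF⟩
    exact ⟨c • F, hF.const_smul c, (Lp.coeFn_smul c a).trans (haF.const_smul c)⟩

/-- The Cauchy-Riemann operator `∂̄ = (∂_x + i ∂_y) / 2`. -/
def dbar (φ : ℂ → ℂ) : ℂ → ℂ :=
  fun z => (1 / 2 : ℂ) * (fderiv ℝ φ z 1 + I * fderiv ℝ φ z I)

/-- `(∂̄)^N u = f` in the sense of distributions on `ℂ`, for locally integrable `u` and `f`
(every element of `L²(μ_m)` is locally integrable). -/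
def DbarEq (N : ℕ) (u f : ℂ → ℂ) : Prop :=
  ∀ φ : ℂ → ℂ, ContDiff ℝ ∞ φ → HasCompactSupport φ →
    ∫ z, u z * (dbar^[N] φ) z = (-1) ^ N * ∫ z, f z * φ z

lemma dbar_contDiff {φ : ℂ → ℂ} (h : ContDiff ℝ ∞ φ) : ContDiff ℝ ∞ (dbar φ) := by
  have h1 : ContDiff ℝ ∞ (fderiv ℝ φ) := h.fderiv_right (by simp)
  unfold dbar
  exact contDiff_const.mul ((h1.clm_apply contDiff_const).add
    (contDiff_const.mul (h1.clm_apply contDiff_const)))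

lemma dbar_compactSupport {φ : ℂ → ℂ} (h : HasCompactSupport φ) :
    HasCompactSupport (dbar φ) := by
  refine (h.fderiv (𝕜 := ℝ)).mono ?_
  intro z hz hz0
  apply hz
  simp [dbar, hz0]

lemma dbar_iterate {φ : ℂ → ℂ} (h : ContDiff ℝ ∞ φ) (hc : HasCompactSupport φ) (N : ℕ) :
    ContDiff ℝ ∞ (dbar^[N] φ) ∧ HasCompactSupport (dbar^[N] φ) := by
  induction N with
  | zero => exact ⟨h, hc⟩
  | succ k ih =>
    rw [Function.iterate_succ_apply']
    exact ⟨dbar_contDiff ih.1, dbar_compactSupport ih.2⟩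

/-- Integration against a continuous compactly supported function is a continuous functional
on `L²(μ_m)`. -/
lemma exists_inner_eq (m : ℝ) {ψ : ℂ → ℂ} (h : Continuous ψ) (hc : HasCompactSupport ψ) :
    ∃ w : L2 m, ∀ u : L2 m, ∫ z, u z * ψ z = inner ℂ w u := by
  have hd : Continuous (fun z : ℂ => Real.exp (-m * ‖z‖ ^ 2) / Real.pi) := by fun_prop
  have hfin : IsFiniteMeasureOnCompacts (μ m) := by
    have : IsLocallyFiniteMeasure (μ m) :=
      IsLocallyFiniteMeasure.withDensity_ofReal hd
    infer_instance
  have hw : Continuous (fun z : ℂ =>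
      conj (ψ z) * ((Real.pi * Real.exp (m * ‖z‖ ^ 2) : ℝ) : ℂ)) := by fun_prop
  have hwc : HasCompactSupport (fun z : ℂ =>
      conj (ψ z) * ((Real.pi * Real.exp (m * ‖z‖ ^ 2) : ℝ) : ℂ)) := by
    refine hc.mono ?_
    intro z hz hz0
    apply hz
    simp [hz0]
  have hL : MemLp _ 2 (μ m) := hw.memLp_of_hasCompactSupport hwc
  refine ⟨hL.toLp _, fun u => ?_⟩
  rw [L2.inner_def]
  have h1 : ∫ z, inner ℂ (hL.toLp _ z) (u z) ∂(μ m)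
      = ∫ z, u z * (ψ z * ((Real.pi * Real.exp (m * ‖z‖ ^ 2) : ℝ) : ℂ)) ∂(μ m) := by
    refine integral_congr_ae ?_
    filter_upwards [hL.coeFn_toLp] with z hz
    rw [hz, RCLike.inner_apply, map_mul, Complex.conj_conj, Complex.conj_ofReal]
  have key : ∀ F : ℂ → ℂ, ∫ z, F z ∂(μ m) =
      ∫ z, (ENNReal.ofReal (Real.exp (-m * ‖z‖ ^ 2) / Real.pi)).toReal • F z := fun F =>
    integral_withDensity_eq_integral_toReal_smul (by fun_prop) (by simp) F
  rw [h1, key]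
  refine integral_congr_ae (Filter.Eventually.of_forall fun z => ?_)
  have hp : (0 : ℝ) ≤ Real.exp (-m * ‖z‖ ^ 2) / Real.pi := by positivity
  have hone : (Real.exp (-m * ‖z‖ ^ 2) / Real.pi) * (Real.pi * Real.exp (m * ‖z‖ ^ 2)) = 1 := by
    have := Real.pi_ne_zero
    field_simp
    rw [← Real.exp_add]
    simp
  simp only [ENNReal.toReal_ofReal hp, Complex.real_smul]
  calc u z * ψ z = u z * ψ z * ((1 : ℝ) : ℂ) := by simp
    _ = _ := by rw [← hone, Complex.ofReal_mul]; ring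

lemma exists_inner_dbar (m : ℝ) (N : ℕ) {φ : ℂ → ℂ} (h : ContDiff ℝ ∞ φ)
    (hc : HasCompactSupport φ) :
    ∃ w : L2 m, ∀ u : L2 m, ∫ z, u z * (dbar^[N] φ) z = inner ℂ w u :=
  exists_inner_eq m (dbar_iterate h hc N).1.continuous (dbar_iterate h hc N).2

/-- The polyanalytic Fock space `F^{N,m}` of order `N`: the kernel of `(∂̄)^N` in `L²(μ_m)`,
derivatives being taken in the sense of distributions. -/
def polyFock (N : ℕ) (m : ℝ) : Submodule ℂ (L2 m) where
  carrier := {u | DbarEq N u (fun _ => 0)}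
  add_mem' := by
    intro a b ha hb φ h hc
    obtain ⟨w, hw⟩ := exists_inner_dbar m N h hc
    have h1 := ha φ h hc
    have h2 := hb φ h hc
    rw [hw] at h1 h2 ⊢
    rw [inner_add_right, h1, h2]
    simp
  zero_mem' := by
    intro φ h hc
    obtain ⟨w, hw⟩ := exists_inner_dbar m N h hc
    rw [hw]
    simp
  smul_mem' := by
    intro c a ha φ h hc
    obtain ⟨w, hw⟩ := exists_inner_dbar m N h hc
    have h1 := ha φ h hc
    rw [hw] at h1 ⊢
    rw [inner_smul_right, h1]
    simp

lemma isClosed_polyFock (N : ℕ) (m : ℝ) : IsClosed (polyFock N m : Set (L2 m)) := by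
  have : (polyFock N m : Set (L2 m)) =
      ⋂ φ : ℂ → ℂ, ⋂ _ : ContDiff ℝ ∞ φ, ⋂ _ : HasCompactSupport φ,
        {u : L2 m | ∫ z, u z * (dbar^[N] φ) z = 0} := by
    ext u
    simp [polyFock, DbarEq]
  rw [this]
  refine isClosed_iInter fun φ => isClosed_iInter fun h => isClosed_iInter fun hc => ?_
  obtain ⟨w, hw⟩ := exists_inner_dbar m N h hc
  simp only [hw]
  exact isClosed_eq (by fun_prop) continuous_const

instance (N : ℕ) (m : ℝ) : CompleteSpace (polyFock N m) :=
  (isClosed_polyFock N m).completeSpace_coe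

lemma memLp_conj_mul_poly {m : ℝ} {g : ℂ → ℂ}
    (hg : ∀ n : ℕ, MemLp (fun z => z ^ n * g z) 2 (μ m)) (p : ℂ[X]) :
    MemLp (fun z => conj (g z) * p.eval z) 2 (μ m) := by
  have h1 : MemLp (fun z => g z * p.eval z) 2 (μ m) := by
    have h2 : MemLp (fun z => ∑ i ∈ p.support, p.coeff i * (z ^ i * g z)) 2 (μ m) :=
      memLp_finsetSum _ fun i _ => (hg i).const_mul (p.coeff i)
    convert h2 using 2 with z
    rw [Polynomial.eval_eq_sum, Polynomial.sum, Finset.mul_sum]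
    exact Finset.sum_congr rfl fun i _ => by ring
  have hg0 : AEStronglyMeasurable g (μ m) := by simpa using (hg 0).1
  refine h1.congr_norm ?_ (Filter.Eventually.of_forall fun z => by simp)
  exact (Complex.continuous_conj.comp_aestronglyMeasurable hg0).mul
    p.continuous.aestronglyMeasurable

/-- The operator `f ↦ (I - P_{F^{N,m}}) (ḡ f)`, defined on analytic polynomials `f`, with values
in `L²(μ_m)`. -/
def hankel (N : ℕ) (m : ℝ) (g : ℂ → ℂ)
    (hg : ∀ n : ℕ, MemLp (fun z => z ^ n * g z) 2 (μ m)) (f : ℂ[X]) : L2 m :=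
  (memLp_conj_mul_poly hg f).toLp _ -
    (polyFock N m).starProjection ((memLp_conj_mul_poly hg f).toLp _)

/-- The bounded operator `T` on `F_m` agrees on every polynomial with the operator `H` given on
polynomials (for `m > 0` every polynomial has its class in `F_m`). -/
def Extends {m : ℝ} (T : fockSpace m →L[ℂ] L2 m) (H : ℂ[X] → L2 m) : Prop :=
  ∀ (p : ℂ[X]) (f : fockSpace m), (f : L2 m) =ᵐ[μ m] (fun z => p.eval z) → T f = H p

/-- `u` is a solution of `(∂̄)^N u = f` of minimal norm in `L²(μ_m)`. -/
def IsMinimalSolution (N : ℕ) {m : ℝ} (f u : L2 m) : Prop :=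
  DbarEq N u f ∧ ∀ v : L2 m, DbarEq N v f → ‖u‖ ≤ ‖v‖

end Fock

end

/-! The proof rests on the creation operator `D v = m z̄ v - ∂v`, the adjoint of `∂̄` in `L²(μ_m)`,
and on the commutation relation `∂̄ D - D ∂̄ = m`. If `p` is holomorphic, then `∂̄ p = 0`, so the
relation gives `∂̄^N D^N p = m^N N! p`. Hence `D^N p / (m^N N!)` solves `∂̄^N u = p`. By adjointness
it is orthogonal to the kernel of `∂̄^N`, so it is the minimal solution, and its norm is `(m^N
N!)^(-1/2) ‖p‖`. Polynomials are dense in `F_m`, so the canonical solution operator `solOp` is a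
nonzero multiple of an isometry on an infinite-dimensional space: bounded and not compact.

If `g` is a polynomial of degree at most `N` with coefficient `a_N` of `z^N`, then `∂̄^N (ḡ p) = N!
conj(a_N) p`. So `ḡ p` differs from a multiple of `solOp p` by an element of the kernel, and the
Hankel operator is `N! conj(a_N)` times `solOp` (`hankel_of_degree_le`). It is compact only when
`a_N = 0`, and then it vanishes.

Conversely, pairing the Hankel operator at `z^(j+l)` with `D^N z^j` isolates one Taylor coefficient
of `g` (`inner_polyCreation_hankel`): the pairing equals `conj(a_{N+l}) ((N+l)!/l!) ‖z^(j+l)‖²`.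
Boundedness and Cauchy-Schwarz bound `|a_{N+l}| ‖z^(j+l)‖` by a constant times `‖z^j‖`. Since
`‖z^n‖² = n!/m^(n+1)`, the ratio of the norms is unbounded in `j` for `l > 0`, so `a_{N+l} = 0`.

Two analytic points remain. Adjointness must pass from compactly supported test functions to
functions of temperate growth, which is done by cutoffs (`inner_creation_iterate`). The pairing with
`g`, which has no growth bound beyond square integrability, is computed by rotation invariance on
balls (`integral_mul_entire`). -/

noncomputable section

namespace Fock

open Function

/-- The Wirtinger derivative `∂ = (∂_x - i ∂_y) / 2`. -/
def del (φ : ℂ → ℂ) : ℂ → ℂ :=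
  fun z => (1 / 2 : ℂ) * (fderiv ℝ φ z 1 - I * fderiv ℝ φ z I)

/-- The creation operator `v ↦ m z̄ v - ∂v`, the formal adjoint of `∂̄` in `L²(μ_m)`. -/
def creation (m : ℝ) (v : ℂ → ℂ) : ℂ → ℂ :=
  fun z => m * conj z * v z - del v z

/-- The density of `μ m`, as a complex function. -/
def gaussian (m : ℝ) (z : ℂ) : ℂ := ((Real.exp (-m * ‖z‖ ^ 2) / Real.pi : ℝ) : ℂ)

/-! ### Stability of temperate growth under `∂` and `D` -/

section TemperateGrowth

variable {v w : ℂ → ℂ}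

lemma hasTemperateGrowth_fderiv (hv : v.HasTemperateGrowth) :
    (fderiv ℝ v).HasTemperateGrowth := by
  refine ⟨hv.1.fderiv_right (by simp), fun n => ?_⟩
  obtain ⟨k, C, h⟩ := hv.2 (n + 1)
  exact ⟨k, C, fun x => by rw [norm_iteratedFDeriv_fderiv]; exact h x⟩

lemma hasTemperateGrowth_fderiv_apply (hv : v.HasTemperateGrowth) (e : ℂ) :
    (fun z => fderiv ℝ v z e).HasTemperateGrowth :=
  ((ContinuousLinearMap.apply ℝ ℂ e).hasTemperateGrowth).comp (hasTemperateGrowth_fderiv hv)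

lemma hasTemperateGrowth_conj (hv : v.HasTemperateGrowth) :
    (fun z => conj (v z)).HasTemperateGrowth :=
  (conjCLE.toContinuousLinearMap.hasTemperateGrowth).comp hv

lemma hasTemperateGrowth_del (hv : v.HasTemperateGrowth) : (del v).HasTemperateGrowth :=
  (HasTemperateGrowth.const _).mul ((hasTemperateGrowth_fderiv_apply hv 1).sub
    ((HasTemperateGrowth.const _).mul (hasTemperateGrowth_fderiv_apply hv I)))

lemma hasTemperateGrowth_creation (m : ℝ) (hv : v.HasTemperateGrowth) :
    (creation m v).HasTemperateGrowth :=
  (((HasTemperateGrowth.const _).mul (hasTemperateGrowth_conj HasTemperateGrowth.id')).mul hv).sub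
    (hasTemperateGrowth_del hv)

lemma hasTemperateGrowth_creation_iterate (m : ℝ) (hv : v.HasTemperateGrowth) (N : ℕ) :
    ((creation m)^[N] v).HasTemperateGrowth := by
  induction N with
  | zero => exact hv
  | succ k ih => rw [iterate_succ_apply']; exact hasTemperateGrowth_creation m ih

lemma hasTemperateGrowth_eval (p : ℂ[X]) : (fun z : ℂ => p.eval z).HasTemperateGrowth := by
  induction p using Polynomial.induction_on' with
  | add p q hp hq => simpa using! hp.add hq
  | monomial n a =>
    simpa using! (HasTemperateGrowth.const a).mul ((HasTemperateGrowth.id' (E := ℂ)).pow n)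

end TemperateGrowth

/-! ### Wirtinger calculus and the commutation relation -/

section Calculus

variable {v w : ℂ → ℂ} {z : ℂ}

lemma contDiff_creation (m : ℝ) (hv : ContDiff ℝ ∞ v) : ContDiff ℝ ∞ (creation m v) := by
  have h1 : ContDiff ℝ ∞ (fderiv ℝ v) := hv.fderiv_right (by simp)
  have h2 : ContDiff ℝ ∞ (fun z : ℂ => conj z) := conjCLE.contDiff
  unfold creation del
  exact ((contDiff_const.mul h2).mul hv).sub (contDiff_const.mul
    ((h1.clm_apply contDiff_const).sub (contDiff_const.mul (h1.clm_apply contDiff_const))))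

lemma contDiff_creation_iterate (m : ℝ) (hv : ContDiff ℝ ∞ v) (N : ℕ) :
    ContDiff ℝ ∞ ((creation m)^[N] v) := by
  induction N with
  | zero => exact hv
  | succ k ih => rw [iterate_succ_apply']; exact contDiff_creation m ih

lemma dbar_mul_apply (hv : DifferentiableAt ℝ v z) (hw : DifferentiableAt ℝ w z) :
    dbar (fun z => v z * w z) z = dbar v z * w z + v z * dbar w z := by
  simp only [dbar, fderiv_fun_mul hv hw, _root_.add_apply,
    _root_.smul_apply, smul_eq_mul]
  ring

lemma dbar_sub_apply (hv : DifferentiableAt ℝ v z) (hw : DifferentiableAt ℝ w z) :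
    dbar (fun z => v z - w z) z = dbar v z - dbar w z := by
  simp only [dbar, fderiv_fun_sub hv hw, _root_.sub_apply]
  ring

lemma dbar_add_apply (hv : DifferentiableAt ℝ v z) (hw : DifferentiableAt ℝ w z) :
    dbar (fun z => v z + w z) z = dbar v z + dbar w z := by
  simp only [dbar, fderiv_fun_add hv hw, _root_.add_apply]
  ring

lemma dbar_const_mul_apply (c : ℂ) (hv : DifferentiableAt ℝ v z) :
    dbar (fun z => c * v z) z = c * dbar v z := by
  simp only [dbar, fderiv_const_mul hv, _root_.smul_apply, smul_eq_mul]
  ring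

lemma dbar_conj_apply (hv : DifferentiableAt ℝ v z) :
    dbar (fun z => conj (v z)) z = conj (del v z) := by
  have h : HasFDerivAt (fun z => conj (v z))
      ((conjCLE : ℂ →L[ℝ] ℂ).comp (fderiv ℝ v z)) z :=
    (conjCLE : ℂ →L[ℝ] ℂ).hasFDerivAt.comp z hv.hasFDerivAt
  rw [dbar, del, h.fderiv]
  simp [map_ofNat]

lemma dbar_eq_zero_of_holomorphic (hv : DifferentiableAt ℂ v z) : dbar v z = 0 := by
  rw [dbar, hv.hasFDerivAt.restrictScalars ℝ |>.fderiv]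
  have : fderiv ℂ v z I = I * fderiv ℂ v z 1 := by
    rw [← smul_eq_mul, ← map_smul]; simp
  simp only [ContinuousLinearMap.coe_restrictScalars', this]
  linear_combination (1 / 2 : ℂ) * fderiv ℂ v z 1 * I_mul_I

lemma del_eq_deriv (hv : DifferentiableAt ℂ v z) : del v z = deriv v z := by
  rw [del, hv.hasFDerivAt.restrictScalars ℝ |>.fderiv]
  have : fderiv ℂ v z I = I * fderiv ℂ v z 1 := by
    rw [← smul_eq_mul, ← map_smul]; simp
  simp only [ContinuousLinearMap.coe_restrictScalars', this, fderiv_apply_one_eq_deriv]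
  linear_combination -(1 / 2 : ℂ) * deriv v z * I_mul_I

lemma contDiff_gaussian (m : ℝ) : ContDiff ℝ ∞ (gaussian m) :=
  ofRealCLM.contDiff.comp ((Real.contDiff_exp.comp
    (contDiff_const.mul (contDiff_norm_sq ℝ))).div_const Real.pi)

lemma dbar_gaussian (m : ℝ) (z : ℂ) : dbar (gaussian m) z = -m * z * gaussian m z := by
  have h : HasFDerivAt (fun z : ℂ => ‖z‖ ^ 2) (2 • innerSL ℝ z) z :=
    (hasStrictFDerivAt_norm_sq z).hasFDerivAt
  have h2 := ((h.const_mul (-m)).exp.mul_const (Real.pi)⁻¹)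
  have h3 := (ofRealCLM.hasFDerivAt.comp z h2).fderiv
  have h4 : gaussian m = ofRealCLM ∘ fun z : ℂ => Real.exp (-m * ‖z‖ ^ 2) * (Real.pi)⁻¹ := by
    ext z; simp [gaussian, div_eq_mul_inv]
  rw [dbar, h4, h3]
  simp [innerSL_apply_apply, Complex.inner]
  linear_combination (-(m : ℂ) * cexp (-(m * ‖z‖ ^ 2)) * (Real.pi : ℂ)⁻¹) * re_add_im z

lemma dbar_del_comm (hv : ContDiff ℝ ∞ v) : dbar (del v) = del (dbar v) := by
  have h1 : ContDiff ℝ ∞ (fderiv ℝ v) := hv.fderiv_right (by simp)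
  have hd : ∀ z, DifferentiableAt ℝ (fderiv ℝ v) z := fun z => h1.differentiable (by simp) z
  have hA : ∀ (z e : ℂ), fderiv ℝ (fun z => fderiv ℝ v z e) z
      = (fderiv ℝ (fderiv ℝ v) z).flip e := by
    intro z e
    ext
    all_goals simp [fderiv_clm_apply (hd z) (differentiableAt_const e)]
  have hda : ∀ (z e : ℂ), DifferentiableAt ℝ (fun z => fderiv ℝ v z e) z := fun z e =>
    (hd z).clm_apply (differentiableAt_const e)
  have hs : ∀ z a b, fderiv ℝ (fderiv ℝ v) z a b = fderiv ℝ (fderiv ℝ v) z b a := fun z a b =>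
    (hv.contDiffAt.isSymmSndFDerivAt (by simp; exact WithTop.coe_le_coe.2 le_top)).eq a b
  ext z
  have e1 : fderiv ℝ (del v) z = (1 / 2 : ℂ) • ((fderiv ℝ (fderiv ℝ v) z).flip 1
      - I • (fderiv ℝ (fderiv ℝ v) z).flip I) := by
    unfold del
    rw [fderiv_const_mul (by exact (hda z 1).sub ((hda z I).const_mul I)),
      fderiv_fun_sub (hda z 1) ((hda z I).const_mul I), fderiv_const_mul (hda z I), hA, hA]
  have e2 : fderiv ℝ (dbar v) z = (1 / 2 : ℂ) • ((fderiv ℝ (fderiv ℝ v) z).flip 1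
      + I • (fderiv ℝ (fderiv ℝ v) z).flip I) := by
    unfold dbar
    rw [fderiv_const_mul (by exact (hda z 1).add ((hda z I).const_mul I)),
      fderiv_fun_add (hda z 1) ((hda z I).const_mul I), fderiv_const_mul (hda z I), hA, hA]
  rw [dbar, del, e1, e2]
  simp only [_root_.smul_apply, _root_.sub_apply,
    _root_.add_apply, ContinuousLinearMap.flip_apply, smul_eq_mul, hs z I 1]
  ring

/-- Pointwise source of the adjointness: differentiating the weight supplies the term `m z̄ v` of `D
v`, and `∂̄` of `v̄` supplies `∂v`. -/
lemma dbar_conj_mul_gaussian (m : ℝ) (hv : ContDiff ℝ ∞ v) :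
    dbar (fun z => conj (v z) * gaussian m z)
      = fun z => conj (-creation m v z) * gaussian m z := by
  ext z
  have hvz : DifferentiableAt ℝ v z := hv.differentiable (by simp) z
  have hg : DifferentiableAt ℝ (gaussian m) z :=
    (contDiff_gaussian m).differentiable (by simp) z
  have hc : DifferentiableAt ℝ (fun z => conj (v z)) z := conjCLE.differentiableAt.comp z hvz
  rw [dbar_mul_apply hc hg, dbar_conj_apply hvz, dbar_gaussian]
  simp [creation]
  ring

/-- The commutation relation. It holds because `∂̄ z̄ = 1` and `∂̄` commutes with `∂`. -/
lemma dbar_creation (m : ℝ) (hv : ContDiff ℝ ∞ v) :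
    dbar (creation m v) = fun z => creation m (dbar v) z + m * v z := by
  ext z
  have hvz : DifferentiableAt ℝ v z := hv.differentiable (by simp) z
  have hc : DifferentiableAt ℝ (fun z : ℂ => conj z) z := conjCLE.differentiableAt
  have hdel : DifferentiableAt ℝ (del v) z := by
    have h1 : ContDiff ℝ ∞ (fderiv ℝ v) := hv.fderiv_right (by simp)
    have : ContDiff ℝ ∞ (del v) := contDiff_const.mul
      ((h1.clm_apply contDiff_const).sub (contDiff_const.mul (h1.clm_apply contDiff_const)))
    exact this.differentiable (by simp) z
  have hmc : DifferentiableAt ℝ (fun z : ℂ => m * conj z) z := hc.const_mul _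
  have h1 : dbar (fun z : ℂ => conj z) z = 1 := by
    rw [dbar_conj_apply (v := fun z => z) differentiableAt_fun_id,
      del_eq_deriv differentiableAt_fun_id]
    simp
  unfold creation
  rw [dbar_sub_apply (by exact hmc.mul hvz) hdel, dbar_del_comm hv,
    dbar_mul_apply hmc hvz, dbar_const_mul_apply _ hc, h1]
  ring

lemma creation_add (m : ℝ) (hv : ContDiff ℝ ∞ v) (hw : ContDiff ℝ ∞ w) :
    creation m (v + w) = creation m v + creation m w := by
  ext z
  simp only [creation, del, Pi.add_apply, fderiv_add (hv.differentiable (by simp) z)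
    (hw.differentiable (by simp) z), _root_.add_apply]
  ring

lemma creation_smul (m : ℝ) (c : ℂ) (hv : ContDiff ℝ ∞ v) :
    creation m (c • v) = c • creation m v := by
  ext z
  simp only [creation, del, Pi.smul_apply, fderiv_const_smul (hv.differentiable (by simp) z),
    _root_.smul_apply, smul_eq_mul]
  ring

lemma creation_iterate_add (m : ℝ) (hv : ContDiff ℝ ∞ v) (hw : ContDiff ℝ ∞ w) (N : ℕ) :
    (creation m)^[N] (v + w) = (creation m)^[N] v + (creation m)^[N] w := by
  induction N with
  | zero => rfl
  | succ k ih =>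
    simp only [iterate_succ_apply']
    rw [ih, creation_add m (contDiff_creation_iterate m hv k) (contDiff_creation_iterate m hw k)]

lemma creation_iterate_smul (m : ℝ) (c : ℂ) (hv : ContDiff ℝ ∞ v) (N : ℕ) :
    (creation m)^[N] (c • v) = c • (creation m)^[N] v := by
  induction N with
  | zero => rfl
  | succ k ih =>
    simp only [iterate_succ_apply']
    rw [ih, creation_smul m c (contDiff_creation_iterate m hv k)]

lemma dbar_iterate_smul (c : ℂ) (hv : ContDiff ℝ ∞ v) (N : ℕ) :
    dbar^[N] (c • v) = c • dbar^[N] v := by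
  induction N generalizing v with
  | zero => rfl
  | succ k ih =>
    simp only [iterate_succ_apply]
    rw [← ih (dbar_contDiff hv)]
    congr 1
    ext z
    exact dbar_const_mul_apply c (hv.differentiable (by simp) z)

lemma dbar_iterate_sub (hv : ContDiff ℝ ∞ v) (hw : ContDiff ℝ ∞ w) (N : ℕ) :
    dbar^[N] (v - w) = dbar^[N] v - dbar^[N] w := by
  induction N generalizing v w with
  | zero => rfl
  | succ k ih =>
    simp only [iterate_succ_apply]
    rw [← ih (dbar_contDiff hv) (dbar_contDiff hw)]
    congr 1
    ext z
    exact dbar_sub_apply (hv.differentiable (by simp) z) (hw.differentiable (by simp) z)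

/-- Moving `∂̄` past each of the `N + 1` factors `D` leaves one multiple `m`, and the last term
vanishes since `∂̄ v = 0`. -/
lemma dbar_creation_iterate (m : ℝ) (hv : ContDiff ℝ ∞ v) (h0 : dbar v = 0) (N : ℕ) :
    dbar ((creation m)^[N + 1] v) = ((N + 1 : ℂ) * m) • (creation m)^[N] v := by
  induction N with
  | zero =>
    rw [iterate_succ_apply', iterate_zero_apply, dbar_creation m hv, h0]
    ext z
    simp [creation, del]
  | succ k ih =>
    rw [iterate_succ_apply', dbar_creation m (contDiff_creation_iterate m hv _), ih,
      creation_smul _ _ (contDiff_creation_iterate m hv _), iterate_succ_apply']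
    ext z
    simp
    ring

lemma dbar_iterate_creation_iterate (m : ℝ) (hv : ContDiff ℝ ∞ v) (h0 : dbar v = 0) (N : ℕ) :
    dbar^[N] ((creation m)^[N] v) = ((m : ℂ) ^ N * N.factorial) • v := by
  induction N with
  | zero => simp
  | succ k ih =>
    rw [iterate_succ_apply, dbar_creation_iterate m hv h0,
      dbar_iterate_smul _ (contDiff_creation_iterate m hv k), ih, smul_smul,
      Nat.factorial_succ]
    push_cast
    ring_nf

lemma contDiff_eval (p : ℂ[X]) : ContDiff ℝ ∞ (fun z : ℂ => p.eval z) :=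
  (hasTemperateGrowth_eval p).1

lemma dbar_eval (p : ℂ[X]) : dbar (fun z => p.eval z) = 0 := by
  ext z
  exact dbar_eq_zero_of_holomorphic p.differentiableAt

lemma dbar_iterate_conj_mul (q p : ℂ[X]) (N : ℕ) :
    dbar^[N] (fun z => conj (q.eval z) * p.eval z)
      = fun z => conj ((Polynomial.derivative^[N] q).eval z) * p.eval z := by
  induction N generalizing q with
  | zero => rfl
  | succ k ih =>
    rw [iterate_succ_apply, iterate_succ_apply, ← ih]
    congr 1
    ext z
    have hq : DifferentiableAt ℝ (fun z => q.eval z) z := (contDiff_eval q).differentiable (by simp) z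
    have hc : DifferentiableAt ℝ (fun z => conj (q.eval z)) z :=
      conjCLE.differentiableAt.comp z hq
    rw [dbar_mul_apply hc
      ((contDiff_eval p).differentiable (by simp) z), dbar_conj_apply hq, dbar_eval,
      del_eq_deriv q.differentiableAt, Polynomial.deriv]
    simp

end Calculus

/-! ### Rotation weights and the creation operator -/

section Rotation

variable {v : ℂ → ℂ} {ζ c : ℂ}

/-- Multiplication by `z̄` and the derivative `∂` both lower the angular weight by one, hence so
does `D`. -/
lemma creation_rotation (m : ℝ) (hv : ContDiff ℝ ∞ v) (hζ : ‖ζ‖ = 1)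
    (h : ∀ z, v (ζ * z) = c * v z) (z : ℂ) :
    creation m v (ζ * z) = conj ζ * c * creation m v z := by
  have hζζ : conj ζ * ζ = 1 := by rw [conj_mul', hζ]; simp
  have hd : ∀ z, DifferentiableAt ℝ v z := fun z => hv.differentiable (by simp) z
  -- Differentiate `v (ζ z) = c v z` in two ways; the directions `1` and `I` then combine to the
  -- chain rule for `∂`.
  have key : ∀ e, fderiv ℝ v (ζ * z) (ζ * e) = c * fderiv ℝ v z e := by
    intro e
    have h1 : HasFDerivAt (fun z => v (ζ * z))
        ((fderiv ℝ v (ζ * z)).comp (ContinuousLinearMap.mul ℝ ℂ ζ)) z :=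
      (hd (ζ * z)).hasFDerivAt.comp z (ContinuousLinearMap.mul ℝ ℂ ζ).hasFDerivAt
    have h2 : HasFDerivAt (fun z => v (ζ * z)) (c • fderiv ℝ v z) z := by
      simp only [h]
      exact (hd z).hasFDerivAt.const_mul c
    simpa using! congrArg (fun L => L e) (h1.unique h2)
  have hlin : ∀ e : ℂ, fderiv ℝ v (ζ * z) e
      = e.re * fderiv ℝ v (ζ * z) 1 + e.im * fderiv ℝ v (ζ * z) I := by
    intro e
    conv_lhs => rw [show e = e.re • (1 : ℂ) + e.im • I by simp [re_add_im]]
    rw [map_add, map_smul, map_smul]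
    simp
  have k1 := key 1
  have k2 := key I
  rw [hlin] at k1 k2
  simp only [mul_one, mul_re, I_re, mul_zero, I_im, zero_sub, ofReal_neg, mul_im, add_zero] at k1 k2
  have hre := re_add_im ζ
  have hdel : ζ * del v (ζ * z) = c * del v z := by
    rw [del, del]
    nth_rewrite 1 [← hre]
    linear_combination (1 / 2 : ℂ) * k1 - (1 / 2 : ℂ) * I * k2
      - (1 / 2 : ℂ) * (ζ.im : ℂ) * fderiv ℝ v (ζ * z) I * I_mul_I
  have hdel' : del v (ζ * z) = conj ζ * c * del v z := by
    linear_combination conj ζ * hdel - del v (ζ * z) * hζζ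
  rw [creation, creation, hdel', h, map_mul]
  ring

lemma creation_iterate_rotation (m : ℝ) (hv : ContDiff ℝ ∞ v) (hζ : ‖ζ‖ = 1)
    (h : ∀ z, v (ζ * z) = c * v z) (N : ℕ) (z : ℂ) :
    (creation m)^[N] v (ζ * z) = conj ζ ^ N * c * (creation m)^[N] v z := by
  induction N generalizing z with
  | zero => simpa using h z
  | succ k ih =>
    rw [iterate_succ_apply', creation_rotation m (contDiff_creation_iterate m hv k) hζ ih]
    ring

end Rotation

end Fock

end

noncomputable section

namespace Fock

open Function Filter
open scoped Topology ENNReal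

/-! ### Gaussian moments and pairings in `L²(μ_m)` -/

section Measure

variable {m : ℝ}

/-- Distributional pairings integrate against area measure, so identities valid almost everywhere
for `μ m` have to be transferred to it. -/
lemma volume_absolutelyContinuous_μ (m : ℝ) : (volume : Measure ℂ) ≪ μ m := by
  refine withDensity_absolutelyContinuous' (by fun_prop) (Eventually.of_forall fun z => ?_)
  simp only [ne_eq, ENNReal.ofReal_eq_zero, not_le]
  positivity

lemma integral_μ (m : ℝ) (F : ℂ → ℂ) : ∫ z, F z ∂(μ m) = ∫ z, F z * gaussian m z := by
  have h := integral_withDensity_eq_integral_toReal_smul (μ := (volume : Measure ℂ))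
    (f := fun z => ENNReal.ofReal (Real.exp (-m * ‖z‖ ^ 2) / Real.pi)) (by fun_prop) (by simp) F
  rw [μ, h]
  refine integral_congr_ae (Eventually.of_forall fun z => ?_)
  have hp : (0 : ℝ) ≤ Real.exp (-m * ‖z‖ ^ 2) / Real.pi := by positivity
  simp only [ENNReal.toReal_ofReal hp, real_smul, gaussian]
  ring

lemma integrable_μ_iff (m : ℝ) (F : ℂ → ℂ) :
    Integrable F (μ m) ↔ Integrable (fun z => F z * gaussian m z) := by
  have h := integrable_withDensity_iff_integrable_smul' (μ := (volume : Measure ℂ))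
    (f := fun z => ENNReal.ofReal (Real.exp (-m * ‖z‖ ^ 2) / Real.pi)) (g := F)
    (by fun_prop) (by simp)
  rw [μ, h]
  refine integrable_congr (Eventually.of_forall fun z => ?_)
  have hp : (0 : ℝ) ≤ Real.exp (-m * ‖z‖ ^ 2) / Real.pi := by positivity
  simp only [ENNReal.toReal_ofReal hp, real_smul, gaussian]
  ring

lemma integral_norm_pow_mul_gaussian (hm : 0 < m) (n : ℕ) :
    ∫ z : ℂ, ‖z‖ ^ (2 * n) * Real.exp (-m * ‖z‖ ^ 2)
      = Real.pi * (n.factorial / m ^ (n + 1)) := by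
  have h := Complex.integral_rpow_mul_exp_neg_mul_rpow (p := 2) (q := (2 * n : ℕ)) (b := m)
    (by norm_num) (lt_of_lt_of_le (by norm_num) (Nat.cast_nonneg _)) hm
  simp only [Real.rpow_natCast, Real.rpow_two] at h
  rw [h]
  have h1 : (((2 * n : ℕ) : ℝ) + 2) / 2 = n + 1 := by push_cast; ring
  have h2 : -(((2 * n : ℕ) : ℝ) + 2) / 2 = -((n + 1 : ℕ) : ℝ) := by push_cast; ring
  rw [h1, h2, Real.Gamma_nat_eq_factorial, Real.rpow_neg hm.le, Real.rpow_natCast]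
  field_simp

/-- A non-integrable function has integral `0` by convention, while the moment formula gives a
positive value. -/
lemma integrable_norm_pow_mul_gaussian (hm : 0 < m) (n : ℕ) :
    Integrable (fun z : ℂ => ‖z‖ ^ (2 * n) * Real.exp (-m * ‖z‖ ^ 2)) := by
  by_contra h
  have h1 := integral_norm_pow_mul_gaussian hm n
  rw [integral_undef h] at h1
  have : 0 < Real.pi * (n.factorial / m ^ (n + 1)) := by positivity
  exact this.ne h1

lemma memLp_of_hasTemperateGrowth (hm : 0 < m) {v : ℂ → ℂ} (hv : v.HasTemperateGrowth) :
    MemLp v 2 (μ m) := by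
  rw [memLp_two_iff_integrable_sq_norm hv.1.continuous.aestronglyMeasurable]
  obtain ⟨k, C, h⟩ := hv.2 0
  have hint : Integrable (fun z : ℂ => (((‖v z‖ ^ 2 : ℝ) : ℂ))) (μ m) := by
    rw [integrable_μ_iff]
    have hdom : Integrable (fun z : ℂ => C ^ 2 * 2 ^ (2 * k - 1) *
        (‖z‖ ^ (2 * 0) * Real.exp (-m * ‖z‖ ^ 2) + ‖z‖ ^ (2 * k) * Real.exp (-m * ‖z‖ ^ 2))) :=
      ((integrable_norm_pow_mul_gaussian hm 0).add
        (integrable_norm_pow_mul_gaussian hm k)).const_mul _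
    refine hdom.mono' ?_ (Eventually.of_forall fun z => ?_)
    · exact ((continuous_ofReal.comp (hv.1.continuous.norm.pow 2)).mul
        (contDiff_gaussian m).continuous).aestronglyMeasurable
    · have hz : ‖v z‖ ≤ C * (1 + ‖z‖) ^ k := by simpa using h z
      have h1 : ‖v z‖ ^ 2 ≤ C ^ 2 * (1 + ‖z‖) ^ (2 * k) := by
        calc ‖v z‖ ^ 2 ≤ (C * (1 + ‖z‖) ^ k) ^ 2 := by gcongr
          _ = _ := by ring
      have h2 : (1 + ‖z‖) ^ (2 * k) ≤ 2 ^ (2 * k - 1) * (1 ^ (2 * k) + ‖z‖ ^ (2 * k)) :=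
        add_pow_le zero_le_one (norm_nonneg z) _
      have h3 : Real.exp (-m * ‖z‖ ^ 2) / Real.pi ≤ Real.exp (-m * ‖z‖ ^ 2) :=
        div_le_self (Real.exp_pos _).le (by linarith [Real.pi_gt_three])
      have h4 : 0 ≤ Real.exp (-m * ‖z‖ ^ 2) / Real.pi := by positivity
      rw [norm_mul, gaussian, norm_real, norm_real, Real.norm_of_nonneg (by positivity),
        Real.norm_of_nonneg h4]
      calc _ ≤ (C ^ 2 * (2 ^ (2 * k - 1) * (1 ^ (2 * k) + ‖z‖ ^ (2 * k))))
              * Real.exp (-m * ‖z‖ ^ 2) := by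
            refine mul_le_mul (h1.trans ?_) h3 h4 (by positivity)
            gcongr
        _ = _ := by ring
  refine hint.re.congr (Eventually.of_forall fun z => ?_)
  exact ofReal_re _

/-- The class in `L²(μ_m)` of a smooth function of temperate growth. -/
def tgL2 (hm : 0 < m) {v : ℂ → ℂ} (hv : v.HasTemperateGrowth) : L2 m :=
  (memLp_of_hasTemperateGrowth hm hv).toLp v

lemma coeFn_tgL2 (hm : 0 < m) {v : ℂ → ℂ} (hv : v.HasTemperateGrowth) :
    tgL2 hm hv =ᵐ[μ m] v :=
  MemLp.coeFn_toLp _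

lemma inner_toLp (u : L2 m) {v : ℂ → ℂ} (hv : MemLp v 2 (μ m)) :
    inner ℂ (hv.toLp v) u = ∫ z, conj (v z) * u z ∂(μ m) := by
  rw [L2.inner_def]
  refine integral_congr_ae ?_
  filter_upwards [hv.coeFn_toLp] with z hz
  rw [hz, RCLike.inner_apply, mul_comm]

lemma integrable_conj_mul {v : ℂ → ℂ} {u : ℂ → ℂ} (hv : MemLp v 2 (μ m))
    (hu : MemLp u 2 (μ m)) : Integrable (fun z => conj (v z) * u z) (μ m) :=
  hv.star.integrable_mul hu

lemma inner_tgL2 (hm : 0 < m) {v : ℂ → ℂ} (hv : v.HasTemperateGrowth) (u : L2 m) :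
    inner ℂ (tgL2 hm hv) u = ∫ z, u z * (conj (v z) * gaussian m z) := by
  rw [tgL2, inner_toLp, integral_μ]
  congr 1
  ext z
  ring

lemma inner_tgL2_tgL2 (hm : 0 < m) {v w : ℂ → ℂ} (hv : v.HasTemperateGrowth)
    (hw : w.HasTemperateGrowth) :
    inner ℂ (tgL2 hm hv) (tgL2 hm hw) = ∫ z, conj (v z) * w z ∂(μ m) := by
  rw [tgL2, inner_toLp]
  refine integral_congr_ae ?_
  filter_upwards [coeFn_tgL2 hm hw] with z hz
  rw [hz]

lemma integrable_mul_gaussian (u : L2 m) {w : ℂ → ℂ} (hw : MemLp w 2 (μ m)) :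
    Integrable (fun z => u z * (w z * gaussian m z)) := by
  have h := (integrable_μ_iff m _).1 (hw.integrable_mul (Lp.memLp u))
  refine h.congr (Eventually.of_forall fun z => ?_)
  simp only [Pi.mul_apply]
  ring

lemma gaussian_ne_zero (m : ℝ) (z : ℂ) : gaussian m z ≠ 0 := by
  rw [gaussian, ofReal_ne_zero]
  positivity

lemma isFiniteMeasureOnCompacts_μ (m : ℝ) : IsFiniteMeasureOnCompacts (μ m) := by
  have : IsLocallyFiniteMeasure (μ m) :=
    IsLocallyFiniteMeasure.withDensity_ofReal
      (by fun_prop : Continuous fun z : ℂ => Real.exp (-m * ‖z‖ ^ 2) / Real.pi)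
  infer_instance

/-- Dividing `ψ` by the nowhere vanishing weight gives a continuous compactly supported function,
which lies in `L²(μ_m)`. -/
lemma integrable_mul_of_hasCompactSupport (u : L2 m) {ψ : ℂ → ℂ} (h : Continuous ψ)
    (hc : HasCompactSupport ψ) : Integrable (fun z => u z * ψ z) := by
  have := isFiniteMeasureOnCompacts_μ m
  have hw : Continuous (fun z => ψ z / gaussian m z) :=
    h.div (contDiff_gaussian m).continuous (gaussian_ne_zero m)
  have hwc : HasCompactSupport (fun z => ψ z / gaussian m z) := by
    refine hc.mono ?_
    intro z hz hz0
    apply hz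
    simp [hz0]
  refine (integrable_mul_gaussian u (hw.memLp_of_hasCompactSupport hwc)).congr
    (Eventually.of_forall fun z => ?_)
  simp only
  rw [div_mul_cancel₀ _ (gaussian_ne_zero m z)]

end Measure

/-! ### Distributional `∂̄^N` and its adjoint -/

section Distributions

variable {u u' f f' φ ψ : ℂ → ℂ} {N : ℕ} {m : ℝ}

lemma DbarEq.congr (h : DbarEq N u f) (hu : u =ᵐ[μ m] u') (hf : f =ᵐ[μ m] f') :
    DbarEq N u' f' := by
  intro φ h1 h2
  have hu' := (volume_absolutelyContinuous_μ m).ae_eq hu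
  have hf' := (volume_absolutelyContinuous_μ m).ae_eq hf
  have e1 : ∫ z, u' z * (dbar^[N] φ) z = ∫ z, u z * (dbar^[N] φ) z :=
    integral_congr_ae (by filter_upwards [hu'] with z hz; rw [hz])
  have e2 : ∫ z, f' z * φ z = ∫ z, f z * φ z :=
    integral_congr_ae (by filter_upwards [hf'] with z hz; rw [hz])
  rw [e1, e2, h φ h1 h2]

lemma integral_mul_dbar (hu : ContDiff ℝ ∞ u) (hφ : ContDiff ℝ ∞ φ)
    (hc : HasCompactSupport φ) : ∫ z, u z * dbar φ z = -∫ z, dbar u z * φ z := by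
  have hφ' : ContDiff ℝ ∞ (fderiv ℝ φ) := hφ.fderiv_right (by simp)
  have hu' : ContDiff ℝ ∞ (fderiv ℝ u) := hu.fderiv_right (by simp)
  have i1 : ∀ e, Integrable (fun z => fderiv ℝ u z e * φ z) := fun e =>
    ((hu'.clm_apply contDiff_const).continuous.mul hφ.continuous).integrable_of_hasCompactSupport
      hc.mul_left
  have i2 : ∀ e, Integrable (fun z => u z * fderiv ℝ φ z e) := fun e =>
    (hu.continuous.mul (hφ'.clm_apply contDiff_const).continuous).integrable_of_hasCompactSupport
      (hc.fderiv_apply (𝕜 := ℝ) e).mul_left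
  have i3 : Integrable (fun z => u z * φ z) :=
    (hu.continuous.mul hφ.continuous).integrable_of_hasCompactSupport hc.mul_left
  have key : ∀ e, ∫ z, u z * fderiv ℝ φ z e = -∫ z, fderiv ℝ u z e * φ z := fun e =>
    integral_mul_fderiv_eq_neg_fderiv_mul_of_integrable (i1 e) (i2 e) i3
      (fun z _ => hu.differentiable (by simp) z) (fun z _ => hφ.differentiable (by simp) z)
  have e1 : ∫ z, u z * dbar φ z
      = (1 / 2 : ℂ) * ((∫ z, u z * fderiv ℝ φ z 1) + I * ∫ z, u z * fderiv ℝ φ z I) := by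
    rw [← integral_const_mul, ← integral_add (i2 1) ((i2 I).const_mul I), ← integral_const_mul]
    refine integral_congr_ae (Eventually.of_forall fun z => ?_)
    simp only [dbar]
    ring
  have e2 : ∫ z, dbar u z * φ z
      = (1 / 2 : ℂ) * ((∫ z, fderiv ℝ u z 1 * φ z) + I * ∫ z, fderiv ℝ u z I * φ z) := by
    rw [← integral_const_mul, ← integral_add (i1 1) ((i1 I).const_mul I), ← integral_const_mul]
    refine integral_congr_ae (Eventually.of_forall fun z => ?_)
    simp only [dbar]
    ring
  rw [e1, e2, key, key]
  ring

/-- For smooth functions the distributional iterate of `∂̄` is the classical one. -/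
lemma dbarEq_of_contDiff (hu : ContDiff ℝ ∞ u) (N : ℕ) : DbarEq N u (dbar^[N] u) := by
  intro φ h hc
  induction N generalizing u with
  | zero => simp
  | succ k ih =>
    have hk := dbar_iterate h hc k
    rw [iterate_succ_apply', integral_mul_dbar hu hk.1 hk.2, ih (dbar_contDiff hu),
      iterate_succ_apply]
    ring

lemma dbar_iterate_add_const_mul (hφ : ContDiff ℝ ∞ φ) (hψ : ContDiff ℝ ∞ ψ) (c : ℂ) (N : ℕ) :
    dbar^[N] (fun z => φ z + c * ψ z) = fun z => dbar^[N] φ z + c * dbar^[N] ψ z := by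
  induction N generalizing φ ψ with
  | zero => rfl
  | succ k ih =>
    simp only [iterate_succ_apply]
    rw [← ih (dbar_contDiff hφ) (dbar_contDiff hψ)]
    congr 1
    ext z
    have h := hψ.differentiable (by simp) z
    rw [dbar_add_apply (hφ.differentiable (by simp) z) (h.const_mul c), dbar_const_mul_apply c h]

lemma dbar_dilation {χ : ℂ → ℂ} (hχ : ContDiff ℝ ∞ χ) (ε : ℝ) (z : ℂ) :
    dbar (fun z => χ (ε * z)) z = ε * dbar χ (ε * z) := by
  have h1 : HasFDerivAt (fun z : ℂ => χ (ε * z))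
      ((fderiv ℝ χ (ε * z)).comp (ContinuousLinearMap.mul ℝ ℂ ε)) z :=
    (hχ.differentiable (by simp) (ε * z)).hasFDerivAt.comp z
      (ContinuousLinearMap.mul ℝ ℂ (ε : ℂ)).hasFDerivAt
  have h2 : ∀ e : ℂ, fderiv ℝ χ (ε * z) (ε * e) = ε * fderiv ℝ χ (ε * z) e := fun e => by
    rw [← real_smul (x := ε) (z := e), map_smul, real_smul]
  rw [dbar, dbar, h1.fderiv]
  simp only [ContinuousLinearMap.comp_apply, ContinuousLinearMap.mul_apply', h2]
  ring

lemma hasCompactSupport_dilation {χ : ℂ → ℂ} (hχ : HasCompactSupport χ) {ε : ℝ} (hε : ε ≠ 0) :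
    HasCompactSupport (fun z : ℂ => χ (ε * z)) :=
  hχ.comp_homeomorph (Homeomorph.mulLeft₀ (ε : ℂ) (by exact_mod_cast hε))

lemma contDiff_dilation {χ : ℂ → ℂ} (hχ : ContDiff ℝ ∞ χ) (ε : ℝ) :
    ContDiff ℝ ∞ (fun z : ℂ => χ (ε * z)) :=
  hχ.comp (contDiff_const.mul contDiff_id)

lemma contDiff_conj_mul_gaussian {v : ℂ → ℂ} (m : ℝ) (hv : ContDiff ℝ ∞ v) :
    ContDiff ℝ ∞ (fun z => conj (v z) * gaussian m z) :=
  (conjCLE.contDiff.comp hv).mul (contDiff_gaussian m)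

/-- Induction on `N`. One `∂̄` falling on the Gaussian factor replaces `v` by `-D v`; falling on the
cutoff it costs a factor `1/(n+1)` and replaces `χ` by `∂̄ χ`, so that term tends to zero. Since `∂̄
χ` re-enters as a cutoff, `χ 0` is left arbitrary. -/
lemma tendsto_integral_mul_dbar_iterate_cutoff (hm : 0 < m) (u : L2 m) {χ : ℂ → ℂ}
    (hχ : ContDiff ℝ ∞ χ) (hc : HasCompactSupport χ) {v : ℂ → ℂ} (hv : v.HasTemperateGrowth)
    (N : ℕ) :
    Tendsto (fun n : ℕ => ∫ z, u z * (dbar^[N] (fun z =>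
        χ (((1 / ((n : ℝ) + 1) : ℝ) : ℂ) * z) * (conj (v z) * gaussian m z))) z) atTop
      (𝓝 (χ 0 * ∫ z, u z * (dbar^[N] (fun z => conj (v z) * gaussian m z)) z)) := by
  have hε : Tendsto (fun n : ℕ => 1 / ((n : ℝ) + 1)) atTop (𝓝 0) :=
    tendsto_one_div_add_atTop_nhds_zero_nat
  have hε' : Tendsto (fun n : ℕ => ((1 / ((n : ℝ) + 1) : ℝ) : ℂ)) atTop (𝓝 0) := by
    rw [← ofReal_zero]
    exact (continuous_ofReal.tendsto 0).comp hε
  induction N generalizing χ v with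
  | zero =>
    simp only [iterate_zero, id_eq]
    rw [← integral_const_mul]
    obtain ⟨C, hC⟩ := hχ.continuous.bounded_above_of_compact_support hc
    have hint := integrable_mul_gaussian u
      (memLp_of_hasTemperateGrowth hm (hasTemperateGrowth_conj hv))
    refine tendsto_integral_of_dominated_convergence
      (fun z => C * ‖u z * (conj (v z) * gaussian m z)‖) (fun n => ?_) (hint.norm.const_mul C)
      (fun n => Eventually.of_forall fun z => ?_) (Eventually.of_forall fun z => ?_)
    · have h1 : AEStronglyMeasurable (fun z : ℂ => χ (((1 / ((n : ℝ) + 1) : ℝ) : ℂ) * z)) volume :=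
        (contDiff_dilation hχ _).continuous.aestronglyMeasurable
      refine (h1.mul hint.1).congr (Eventually.of_forall fun z => ?_)
      simp only [Pi.mul_apply]
      ring
    · rw [mul_left_comm, norm_mul]
      gcongr
      exact hC _
    · simp only [mul_left_comm (u z)]
      refine Tendsto.mul_const _ ?_
      have h0 := hε'.mul_const z
      rw [zero_mul] at h0
      exact (hχ.continuous.tendsto 0).comp h0
  | succ k ih =>
    have hcv := contDiff_conj_mul_gaussian m hv.1
    have hDv := (hasTemperateGrowth_creation m hv).neg
    have h1 := ih hχ hc hDv
    have h2 := ih (dbar_contDiff hχ) (dbar_compactSupport hc) hv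
    have h3 := h1.add (hε'.mul h2)
    rw [zero_mul, add_zero] at h3
    rw [iterate_succ_apply, dbar_conj_mul_gaussian m hv.1]
    refine h3.congr fun n => ?_
    set ε : ℝ := 1 / ((n : ℝ) + 1) with hεdef
    have hε0 : ε ≠ 0 := by positivity
    have hcD := contDiff_conj_mul_gaussian m hDv.1
    have c1 := (contDiff_dilation hχ ε).mul hcD
    have c2 := (contDiff_dilation (dbar_contDiff hχ) ε).mul hcv
    have s1 := (hasCompactSupport_dilation hc hε0).mul_right
      (f' := fun z => conj ((-creation m v) z) * gaussian m z)
    have s2 := (hasCompactSupport_dilation (dbar_compactSupport hc) hε0).mul_right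
      (f' := fun z => conj (v z) * gaussian m z)
    have hstep : dbar (fun z => χ (ε * z) * (conj (v z) * gaussian m z))
        = fun z => χ (ε * z) * (conj ((-creation m v) z) * gaussian m z)
          + ε * (dbar χ (ε * z) * (conj (v z) * gaussian m z)) := by
      ext z
      rw [dbar_mul_apply ((contDiff_dilation hχ ε).differentiable (by simp) z)
        (hcv.differentiable (by simp) z), dbar_dilation hχ, dbar_conj_mul_gaussian m hv.1,
        Pi.neg_apply]
      ring
    have i1 := integrable_mul_of_hasCompactSupport u (dbar_iterate c1 s1 k).1.continuous
      (dbar_iterate c1 s1 k).2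
    have i2 := integrable_mul_of_hasCompactSupport u (dbar_iterate c2 s2 k).1.continuous
      (dbar_iterate c2 s2 k).2
    rw [iterate_succ_apply, hstep, dbar_iterate_add_const_mul c1 c2, ← integral_const_mul,
      ← integral_add i1 (i2.const_mul _)]
    refine integral_congr_ae (Eventually.of_forall fun z => ?_)
    simp only
    ring

lemma dbar_iterate_conj_mul_gaussian {v : ℂ → ℂ} (m : ℝ) (hv : ContDiff ℝ ∞ v) (N : ℕ) :
    dbar^[N] (fun z => conj (v z) * gaussian m z)
      = fun z => (-1) ^ N * (conj ((creation m)^[N] v z) * gaussian m z) := by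
  induction N with
  | zero => simp
  | succ k ih =>
    have h := contDiff_creation_iterate m hv k
    rw [iterate_succ_apply', ih]
    ext z
    rw [dbar_const_mul_apply _ ((contDiff_conj_mul_gaussian m h).differentiable (by simp) z),
      dbar_conj_mul_gaussian m h, iterate_succ_apply']
    simp
    ring

/-- The iterated creation operator is adjoint to the distributional `∂̄^N`. -/
lemma inner_creation_iterate (hm : 0 < m) {u f : L2 m} (h : DbarEq N u f) {v : ℂ → ℂ}
    (hv : v.HasTemperateGrowth) :
    inner ℂ (tgL2 hm (hasTemperateGrowth_creation_iterate m hv N)) u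
      = inner ℂ (tgL2 hm hv) f := by
  let b : ContDiffBump (0 : ℂ) := default
  let χ : ℂ → ℂ := fun z => (b z : ℂ)
  have hχ : ContDiff ℝ ∞ χ := ofRealCLM.contDiff.comp b.contDiff
  have hc : HasCompactSupport χ := b.hasCompactSupport.comp_left (g := ofReal) ofReal_zero
  have h0 : χ 0 = 1 := by
    have : b 0 = 1 := b.one_of_mem_closedBall (by simp [b.rIn_pos.le])
    simp [χ, this]
  have t1 := tendsto_integral_mul_dbar_iterate_cutoff hm u hχ hc hv N
  have t2 := (tendsto_integral_mul_dbar_iterate_cutoff hm f hχ hc hv 0).const_mul ((-1) ^ N)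
  -- For each `n` the cut-off function is an admissible test function, so the two sequences agree
  -- and so do their limits.
  have heq := tendsto_nhds_unique t1 (t2.congr fun n => by
    have hε0 : (1 / ((n : ℝ) + 1)) ≠ 0 := by positivity
    exact (h _ ((contDiff_dilation hχ _).mul (contDiff_conj_mul_gaussian m hv.1))
      ((hasCompactSupport_dilation hc hε0).mul_right)).symm)
  rw [h0, one_mul, one_mul, dbar_iterate_conj_mul_gaussian m hv.1] at heq
  have e1 : ∫ z, u z * ((-1) ^ N * (conj ((creation m)^[N] v z) * gaussian m z))
      = (-1) ^ N * ∫ z, u z * (conj ((creation m)^[N] v z) * gaussian m z) := by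
    rw [← integral_const_mul]
    congr 1
    ext z
    ring
  rw [e1] at heq
  rw [inner_tgL2, inner_tgL2]
  exact mul_left_cancel₀ (pow_ne_zero N (by norm_num)) heq

lemma inner_creation_iterate_polyFock (hm : 0 < m) {u : L2 m} (h : u ∈ polyFock N m)
    {v : ℂ → ℂ} (hv : v.HasTemperateGrowth) :
    inner ℂ (tgL2 hm (hasTemperateGrowth_creation_iterate m hv N)) u = 0 := by
  have h' : DbarEq N u ((0 : L2 m) : ℂ → ℂ) :=
    DbarEq.congr (m := m) h (Filter.EventuallyEq.refl _ _) (Lp.coeFn_zero _ _ _).symm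
  rw [inner_creation_iterate hm h' hv, inner_zero_right]

/-- The adjoint relation against a smooth function of temperate growth. -/
lemma inner_creation_iterate_tgL2 (hm : 0 < m) {v w w' : ℂ → ℂ} (hv : v.HasTemperateGrowth)
    (hw : w.HasTemperateGrowth) (hw' : w'.HasTemperateGrowth) (h : dbar^[N] w = w') :
    inner ℂ (tgL2 hm (hasTemperateGrowth_creation_iterate m hv N)) (tgL2 hm hw)
      = inner ℂ (tgL2 hm hv) (tgL2 hm hw') := by
  refine inner_creation_iterate hm ?_ hv
  refine DbarEq.congr (m := m) (dbarEq_of_contDiff hw.1 N) (coeFn_tgL2 hm hw).symm ?_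
  rw [h]
  exact (coeFn_tgL2 hm hw').symm

lemma tgL2_mem_polyFock (hm : 0 < m) {w : ℂ → ℂ} (hw : w.HasTemperateGrowth)
    (h : dbar^[N] w = 0) : tgL2 hm hw ∈ polyFock N m := by
  refine DbarEq.congr (m := m) (dbarEq_of_contDiff hw.1 N) (coeFn_tgL2 hm hw).symm ?_
  rw [h]
  rfl

end Distributions

end Fock

end

noncomputable section

namespace Fock

open Function Filter
open scoped Topology ENNReal

/-! ### Taylor coefficients through rotation invariance -/

section Taylor

variable {m : ℝ}

/-- The Taylor coefficient of order `n` at the origin. -/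
def taylorCoeff (g : ℂ → ℂ) (n : ℕ) : ℂ := (n.factorial : ℂ)⁻¹ * iteratedDeriv n g 0

lemma hasSum_taylorCoeff {g : ℂ → ℂ} (hg : Differentiable ℂ g) (z : ℂ) :
    HasSum (fun n => taylorCoeff g n * z ^ n) (g z) := by
  have h := Complex.hasSum_taylorSeries_of_entire hg 0 z
  refine h.congr_fun fun n => ?_
  simp [taylorCoeff]
  ring

/-- Rotations preserve area, so the integral equals its own negative. -/
lemma integral_eq_zero_of_rotation {h : ℂ → ℂ} {ζ : ℂ} (hζ : ‖ζ‖ = 1)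
    (hh : ∀ z, h (ζ * z) = -h z) : ∫ z, h z = 0 := by
  let a : Circle := ⟨ζ, by simpa [Submonoid.unitSphere] using hζ⟩
  have h1 : ∫ z, h (rotation a z) = ∫ z, h z :=
    (rotation a).measurePreserving.integral_comp
      (rotation a).toHomeomorph.measurableEmbedding h
  have h2 : ∀ z, h (rotation a z) = -h z := fun z => by
    rw [rotation_apply]; exact hh z
  simp only [h2, integral_neg] at h1
  exact self_eq_neg.1 h1.symm

lemma exists_root_neg_one {k n : ℕ} (h : n ≠ k) : ∃ ζ : ℂ, ‖ζ‖ = 1 ∧ ζ ^ n = -ζ ^ k := by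
  have key : ∀ k n : ℕ, k < n → ∃ ζ : ℂ, ‖ζ‖ = 1 ∧ ζ ^ n = -ζ ^ k := by
    intro k n hkn
    obtain ⟨d, rfl⟩ := Nat.exists_eq_add_of_lt hkn
    -- Here `d + 1 = n - k`, so `ζ ^ (n - k) = exp (π i) = -1`.
    refine ⟨cexp ((Real.pi / (d + 1 : ℕ) : ℝ) * I), norm_exp_ofReal_mul_I _, ?_⟩
    rw [add_assoc, pow_add, ← Complex.exp_nat_mul _ (d + 1)]
    have : ((d + 1 : ℕ) : ℂ) * (((Real.pi / (d + 1 : ℕ) : ℝ) : ℂ) * I) = Real.pi * I := by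
      have h0 : ((d : ℂ) + 1) ≠ 0 := by exact_mod_cast (Nat.succ_ne_zero d)
      push_cast
      field_simp
    rw [this, exp_pi_mul_I]
    ring
  rcases lt_or_gt_of_ne h with h | h
  · obtain ⟨ζ, h1, h2⟩ := key n k h
    exact ⟨ζ, h1, by rw [h2, neg_neg]⟩
  · exact key k n h

/-- The function `Φ` has angular weight `-k`. Rotating by `ζ` with `ζ ^ n = -ζ ^ k` preserves the
ball and the weight and changes the sign of the integrand. -/
lemma setIntegral_ball_eq_zero {Φ : ℂ → ℂ} {k n : ℕ} (hn : n ≠ k)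
    (hrot : ∀ ζ z : ℂ, ‖ζ‖ = 1 → Φ (ζ * z) * ζ ^ k = Φ z) (R : ℝ) :
    ∫ z in Metric.ball 0 R, Φ z * z ^ n ∂(μ m) = 0 := by
  obtain ⟨ζ, hζ, hpow⟩ := exists_root_neg_one hn
  rw [← integral_indicator Metric.isOpen_ball.measurableSet, integral_μ]
  refine integral_eq_zero_of_rotation hζ fun z => ?_
  have hg : gaussian m (ζ * z) = gaussian m z := by simp [gaussian, hζ]
  have hmem : ζ * z ∈ Metric.ball (0 : ℂ) R ↔ z ∈ Metric.ball (0 : ℂ) R := by simp [hζ]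
  rw [hg]
  by_cases hz : z ∈ Metric.ball (0 : ℂ) R
  · rw [Set.indicator_of_mem hz, Set.indicator_of_mem (hmem.2 hz), mul_pow, hpow]
    linear_combination -(z ^ n * gaussian m z) * hrot ζ z hζ
  · rw [Set.indicator_of_notMem hz, Set.indicator_of_notMem (hmem.not.2 hz)]
    simp

/-- A rotation-homogeneous weight only sees one Taylor coefficient of an entire function. -/
lemma integral_mul_entire {g Φ : ℂ → ℂ} (hg : Differentiable ℂ g) (hΦ : Continuous Φ) {k : ℕ}
    (hrot : ∀ ζ z : ℂ, ‖ζ‖ = 1 → Φ (ζ * z) * ζ ^ k = Φ z)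
    (hi : Integrable (fun z => Φ z * g z) (μ m))
    (hi' : Integrable (fun z => Φ z * z ^ k) (μ m)) :
    ∫ z, Φ z * g z ∂(μ m) = taylorCoeff g k * ∫ z, Φ z * z ^ k ∂(μ m) := by
  have := isFiniteMeasureOnCompacts_μ m
  -- Termwise integration of the Taylor series is legitimate on a ball, where only the term of order
  -- `k` survives; the balls then exhaust the plane.
  have hball : ∀ R : ℕ, ∫ z in Metric.ball 0 (R : ℝ), Φ z * g z ∂(μ m)
      = taylorCoeff g k * ∫ z in Metric.ball 0 (R : ℝ), Φ z * z ^ k ∂(μ m) := by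
    intro R
    obtain ⟨C, hC⟩ := (isCompact_closedBall (0 : ℂ) R).exists_bound_of_continuousOn
      hΦ.continuousOn
    have hfin : μ m (Metric.ball 0 (R : ℝ)) < ⊤ :=
      (measure_mono Metric.ball_subset_closedBall).trans_lt
        (isCompact_closedBall (0 : ℂ) R).measure_lt_top
    have : IsFiniteMeasure ((μ m).restrict (Metric.ball 0 (R : ℝ))) := ⟨by simpa using hfin⟩
    -- On the ball the terms are dominated by those of the Taylor series at the point `R`, which
    -- converges absolutely.
    have hbd : ∀ n, ∀ᵐ z ∂((μ m).restrict (Metric.ball 0 (R : ℝ))),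
        ‖Φ z * (taylorCoeff g n * z ^ n)‖ ≤ C * ‖taylorCoeff g n * (R : ℂ) ^ n‖ := by
      intro n
      filter_upwards [ae_restrict_mem Metric.isOpen_ball.measurableSet] with z hz
      have hz' : ‖z‖ ≤ R := by simpa using (Metric.mem_ball.1 hz).le
      have h1 := hC z (by simpa using hz')
      have h0 : 0 ≤ C := (norm_nonneg _).trans h1
      rw [norm_mul, norm_mul, norm_mul, norm_pow, norm_pow, norm_natCast]
      gcongr
    have hint : ∀ n, Integrable (fun z => Φ z * (taylorCoeff g n * z ^ n))
        ((μ m).restrict (Metric.ball 0 (R : ℝ))) := fun n =>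
      Integrable.of_bound (by fun_prop) _ (hbd n)
    have hsum : Summable fun n => ∫ z in Metric.ball 0 (R : ℝ),
        ‖Φ z * (taylorCoeff g n * z ^ n)‖ ∂(μ m) := by
      have h1 : Summable fun n => ((μ m).real (Metric.ball 0 (R : ℝ))) *
          (C * ‖taylorCoeff g n * (R : ℂ) ^ n‖) :=
        ((hasSum_taylorCoeff hg R).summable.norm.mul_left C).mul_left _
      refine Summable.of_nonneg_of_le (fun n => integral_nonneg fun z => norm_nonneg _)
        (fun n => ?_) h1
      have := integral_mono_ae (hint n).norm (integrable_const _) (hbd n)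
      simpa [Measure.real] using this
    have h2 := hasSum_integral_of_summable_integral_norm hint hsum
    have h3 : ∀ z, ∑' n, Φ z * (taylorCoeff g n * z ^ n) = Φ z * g z := fun z =>
      ((hasSum_taylorCoeff hg z).mul_left (Φ z)).tsum_eq
    simp only [h3] at h2
    have h4 : ∀ n, ∫ z in Metric.ball 0 (R : ℝ), Φ z * (taylorCoeff g n * z ^ n) ∂(μ m)
        = taylorCoeff g n * ∫ z in Metric.ball 0 (R : ℝ), Φ z * z ^ n ∂(μ m) := fun n => by
      rw [← integral_const_mul]
      congr 1
      ext z
      ring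
    simp only [h4] at h2
    exact h2.unique (hasSum_single k fun n hn => by
      rw [setIntegral_ball_eq_zero hn hrot, mul_zero])
  have hmono : Monotone fun R : ℕ => Metric.ball (0 : ℂ) (R : ℝ) := fun a b hab =>
    Metric.ball_subset_ball (by exact_mod_cast hab)
  have t1 := tendsto_setIntegral_of_monotone (μ := μ m)
    (fun R : ℕ => Metric.isOpen_ball.measurableSet) hmono hi.integrableOn
  have t2 := tendsto_setIntegral_of_monotone (μ := μ m)
    (fun R : ℕ => Metric.isOpen_ball.measurableSet) hmono hi'.integrableOn
  rw [Metric.iUnion_ball_nat, setIntegral_univ] at t1 t2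
  simp only [hball] at t1
  exact tendsto_nhds_unique t1 (t2.const_mul _)

end Taylor

/-! ### Monomials as an orthogonal basis of the Fock space -/

section Polynomials

variable {m : ℝ}

lemma tgL2_congr (hm : 0 < m) {v w : ℂ → ℂ} (hv : v.HasTemperateGrowth)
    (hw : w.HasTemperateGrowth) (h : v = w) : tgL2 hm hv = tgL2 hm hw := by
  subst h
  rfl

lemma tgL2_add (hm : 0 < m) {v w : ℂ → ℂ} (hv : v.HasTemperateGrowth)
    (hw : w.HasTemperateGrowth) : tgL2 hm (hv.add hw) = tgL2 hm hv + tgL2 hm hw :=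
  MemLp.toLp_add _ _

lemma hasTemperateGrowth_smul (c : ℂ) {v : ℂ → ℂ} (hv : v.HasTemperateGrowth) :
    (c • v).HasTemperateGrowth :=
  (HasTemperateGrowth.const c).mul hv

lemma tgL2_smul (hm : 0 < m) (c : ℂ) {v : ℂ → ℂ} (hv : v.HasTemperateGrowth) :
    tgL2 hm (hasTemperateGrowth_smul c hv) = c • tgL2 hm hv :=
  MemLp.toLp_const_smul _ _

/-- The class in `L²(μ_m)` of a polynomial, as an element of the Fock space. -/
def polyToFock (hm : 0 < m) : ℂ[X] →ₗ[ℂ] fockSpace m where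
  toFun p := ⟨tgL2 hm (hasTemperateGrowth_eval p), fun z => p.eval z, p.differentiable,
    coeFn_tgL2 hm _⟩
  map_add' p q := Subtype.ext <|
    (tgL2_congr hm (hasTemperateGrowth_eval (p + q))
      ((hasTemperateGrowth_eval p).add (hasTemperateGrowth_eval q)) (by ext z; simp)).trans
      (tgL2_add hm (hasTemperateGrowth_eval p) (hasTemperateGrowth_eval q))
  map_smul' c p := Subtype.ext <|
    (tgL2_congr hm (hasTemperateGrowth_eval (c • p))
      (hasTemperateGrowth_smul c (hasTemperateGrowth_eval p)) (by ext z; simp)).trans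
      (tgL2_smul hm c (hasTemperateGrowth_eval p))

lemma coe_polyToFock (hm : 0 < m) (p : ℂ[X]) :
    (polyToFock hm p : L2 m) = tgL2 hm (hasTemperateGrowth_eval p) := rfl

lemma coeFn_polyToFock (hm : 0 < m) (p : ℂ[X]) :
    (polyToFock hm p : L2 m) =ᵐ[μ m] fun z => p.eval z := by
  rw [coe_polyToFock]
  exact coeFn_tgL2 hm _

lemma inner_monomial (hm : 0 < m) (f : fockSpace m) {F : ℂ → ℂ} (hF : Differentiable ℂ F)
    (hf : (f : L2 m) =ᵐ[μ m] F) (n : ℕ) :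
    inner ℂ (polyToFock hm (Polynomial.X ^ n) : L2 m) (f : L2 m)
      = taylorCoeff F n * ((n.factorial / m ^ (n + 1) : ℝ) : ℂ) := by
  have hX := hasTemperateGrowth_eval (Polynomial.X ^ n : ℂ[X])
  have hmem := memLp_of_hasTemperateGrowth hm hX
  have hFm : MemLp F 2 (μ m) := (memLp_congr_ae hf).1 (Lp.memLp _)
  have h1 : inner ℂ (polyToFock hm (Polynomial.X ^ n) : L2 m) (f : L2 m)
      = ∫ z, conj ((Polynomial.X ^ n : ℂ[X]).eval z) * F z ∂(μ m) := by
    rw [coe_polyToFock, tgL2, inner_toLp]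
    refine integral_congr_ae ?_
    filter_upwards [hf] with z hz
    rw [hz]
  have hi' := integrable_conj_mul hmem hmem
  simp only [Polynomial.eval_pow, Polynomial.eval_X] at hi' h1
  have hi := integrable_conj_mul hmem hFm
  simp only [Polynomial.eval_pow, Polynomial.eval_X] at hi
  have hcont : Continuous fun z : ℂ => conj (z ^ n) := continuous_conj.comp (continuous_pow n)
  rw [h1, integral_mul_entire hF hcont (k := n) ?_ hi hi']
  · congr 1
    rw [integral_μ]
    have h2 : ∀ z : ℂ, conj (z ^ n) * z ^ n * gaussian m z
        = (((‖z‖ ^ (2 * n) * Real.exp (-m * ‖z‖ ^ 2)) * Real.pi⁻¹ : ℝ) : ℂ) := fun z => by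
      rw [map_pow, ← mul_pow, conj_mul', gaussian]
      push_cast
      ring
    simp only [h2]
    rw [integral_complex_ofReal, integral_mul_const, integral_norm_pow_mul_gaussian hm]
    have := Real.pi_ne_zero
    congr 1
    field_simp
  · intro ζ z hζ
    have : conj ζ * ζ = 1 := by rw [conj_mul', hζ]; simp
    rw [mul_pow, map_mul, map_pow, mul_right_comm, ← mul_pow, this, one_pow, one_mul]

lemma taylorCoeff_X_pow (n k : ℕ) :
    taylorCoeff (fun z : ℂ => (Polynomial.X ^ n : ℂ[X]).eval z) k = if k = n then 1 else 0 := by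
  simp only [taylorCoeff, Polynomial.eval_pow, Polynomial.eval_X]
  rw [iteratedDeriv_fun_pow_zero]
  rcases eq_or_ne k n with h | h
  · subst h
    have : (k.factorial : ℂ) ≠ 0 := by exact_mod_cast k.factorial_ne_zero
    simp [this]
  · simp [h]

lemma inner_X_pow (hm : 0 < m) (k n : ℕ) :
    inner ℂ (polyToFock hm (Polynomial.X ^ k) : L2 m) (polyToFock hm (Polynomial.X ^ n) : L2 m)
      = if k = n then ((k.factorial / m ^ (k + 1) : ℝ) : ℂ) else 0 := by
  rw [inner_monomial hm (polyToFock hm (Polynomial.X ^ n))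
    (Polynomial.differentiable (Polynomial.X ^ n : ℂ[X]))
    (coeFn_polyToFock hm _), taylorCoeff_X_pow]
  simp

lemma norm_sq_X_pow (hm : 0 < m) (n : ℕ) :
    ‖(polyToFock hm (Polynomial.X ^ n) : L2 m)‖ ^ 2 = n.factorial / m ^ (n + 1) := by
  have h := inner_X_pow hm n n
  rw [if_pos rfl, inner_self_eq_norm_sq_to_K] at h
  refine ofReal_injective ?_
  rw [← h, ofReal_pow]
  rfl

lemma norm_X_pow_pos (hm : 0 < m) (n : ℕ) : 0 < ‖(polyToFock hm (Polynomial.X ^ n) : L2 m)‖ := by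
  have h := norm_sq_X_pow hm n
  have h2 : (0 : ℝ) < n.factorial / m ^ (n + 1) := by positivity
  rw [← h] at h2
  exact (norm_nonneg _).lt_of_ne fun h0 => by rw [← h0] at h2; simp at h2

/-- The normalised monomials. -/
def fockBasis (hm : 0 < m) (n : ℕ) : L2 m :=
  ((‖(polyToFock hm (Polynomial.X ^ n) : L2 m)‖⁻¹ : ℝ) : ℂ) • (polyToFock hm (Polynomial.X ^ n) : L2 m)

lemma orthonormal_fockBasis (hm : 0 < m) : Orthonormal ℂ (fockBasis hm) := by
  rw [orthonormal_iff_ite]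
  intro i j
  rw [fockBasis, fockBasis, inner_smul_left, inner_smul_right, inner_X_pow, conj_ofReal]
  split_ifs with h
  · subst h
    rw [← norm_sq_X_pow hm, ← ofReal_mul, ← ofReal_mul]
    have := (norm_X_pow_pos hm i).ne'
    rw [ofReal_eq_one]
    field_simp
  · simp

/-- The orthonormal expansion of `f` has the Taylor polynomials of `F` as partial sums. It converges
in `L²` by Bessel, and its limit is identified pointwise. -/
lemma denseRange_polyToFock (hm : 0 < m) : DenseRange (polyToFock hm) := by
  intro f
  obtain ⟨F, hF, hf⟩ := f.2
  let p : ℕ → ℂ[X] := fun M =>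
    ∑ n ∈ Finset.range M, taylorCoeff F n • (Polynomial.X ^ n : ℂ[X])
  have hcoef : ∀ n, (inner ℂ (fockBasis hm n) (f : L2 m) : ℂ) • fockBasis hm n
      = taylorCoeff F n • (polyToFock hm (Polynomial.X ^ n) : L2 m) := by
    intro n
    rw [fockBasis, inner_smul_left, inner_monomial hm f hF hf, smul_smul, conj_ofReal,
      ← norm_sq_X_pow hm]
    congr 1
    have := (norm_X_pow_pos hm n).ne'
    have h' : ((‖(polyToFock hm (Polynomial.X ^ n) : L2 m)‖ : ℝ) : ℂ) ≠ 0 := by exact_mod_cast this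
    push_cast
    field_simp
  have hort := orthonormal_fockBasis hm
  have hs : Summable fun n => (inner ℂ (fockBasis hm n) (f : L2 m) : ℂ) • fockBasis hm n := by
    have h1 : Summable fun n => ‖(inner ℂ (fockBasis hm n) (f : L2 m) : ℂ)‖ ^ 2 :=
      hort.inner_products_summable _
    exact (hort.orthogonalFamily.summable_iff_norm_sq_summable
      fun n => (inner ℂ (fockBasis hm n) (f : L2 m) : ℂ)).2 h1
  obtain ⟨G, hG⟩ := hs
  have hp : ∀ M, (polyToFock hm (p M) : L2 m)
      = ∑ n ∈ Finset.range M, (inner ℂ (fockBasis hm n) (f : L2 m) : ℂ) • fockBasis hm n := by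
    intro M
    rw [Finset.sum_congr rfl fun n _ => hcoef n]
    simp [p]
  have ht : Tendsto (fun M => (polyToFock hm (p M) : L2 m)) atTop (𝓝 G) := by
    simp only [hp]
    exact hG.tendsto_sum_nat
  have hGf : G = f := by
    -- A subsequence converges almost everywhere to `G`, whereas the Taylor polynomials converge
    -- everywhere to `F`.
    obtain ⟨φ, hφ, hae⟩ := (tendstoInMeasure_of_tendsto_Lp ht).exists_seq_tendsto_ae
    have hall : ∀ᵐ z ∂(μ m), ∀ M, (polyToFock hm (p M) : L2 m) z = (p M).eval z :=
      ae_all_iff.2 fun M => coeFn_polyToFock hm (p M)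
    refine Lp.ext ?_
    filter_upwards [hae, hall, hf] with z h1 h2 h3
    rw [h3]
    have h4 : Tendsto (fun M => (p M).eval z) atTop (𝓝 (F z)) := by
      refine (hasSum_taylorCoeff hF z).tendsto_sum_nat.congr fun M => ?_
      simp [p, Polynomial.eval_finsetSum]
    simp only [h2] at h1
    exact tendsto_nhds_unique h1 (h4.comp hφ.tendsto_atTop)
  rw [hGf] at ht
  exact mem_closure_of_tendsto (tendsto_subtype_rng.2 ht)
    (Eventually.of_forall fun M => Set.mem_range_self (p M))

end Polynomials

end Fock

end

noncomputable section

namespace Fock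

open Function Filter
open scoped Topology ENNReal

/-! ### The canonical solution operator -/

section SolutionOperator

variable {m : ℝ}

/-- The class of `D^N p`, where `D` is the creation operator and `p` is a polynomial. -/
def polyCreation (hm : 0 < m) (N : ℕ) : ℂ[X] →ₗ[ℂ] L2 m where
  toFun p := tgL2 hm (hasTemperateGrowth_creation_iterate m (hasTemperateGrowth_eval p) N)
  map_add' p q := by
    rw [← tgL2_add]
    refine tgL2_congr hm _ _ ?_
    rw [← creation_iterate_add m (contDiff_eval p) (contDiff_eval q)]
    congr 1
    ext z
    simp
  map_smul' c p := by
    rw [RingHom.id_apply, ← tgL2_smul]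
    refine tgL2_congr hm _ _ ?_
    rw [← creation_iterate_smul m c (contDiff_eval p)]
    congr 1
    ext z
    simp

lemma polyCreation_apply (hm : 0 < m) (N : ℕ) (p : ℂ[X]) : polyCreation hm N p
    = tgL2 hm (hasTemperateGrowth_creation_iterate m (hasTemperateGrowth_eval p) N) := rfl

/-- Adjointness turns `⟨D^N p, D^N p⟩` into `⟨p, ∂̄^N D^N p⟩`, and the commutation relation
evaluates the right-hand entry. -/
lemma norm_sq_polyCreation (hm : 0 < m) (N : ℕ) (p : ℂ[X]) :
    ‖polyCreation hm N p‖ ^ 2 = m ^ N * N.factorial * ‖polyToFock hm p‖ ^ 2 := by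
  have hp := hasTemperateGrowth_eval p
  have h := inner_creation_iterate_tgL2 hm (N := N) hp
    (hasTemperateGrowth_creation_iterate m hp N)
    (hasTemperateGrowth_smul ((m : ℂ) ^ N * N.factorial) hp)
    (dbar_iterate_creation_iterate m hp.1 (dbar_eval p) N)
  rw [tgL2_smul hm _ hp, inner_smul_right, ← polyCreation_apply, ← coe_polyToFock,
    inner_self_eq_norm_sq_to_K, inner_self_eq_norm_sq_to_K] at h
  refine ofReal_injective ?_
  push_cast
  exact h

/-- The constant `m ^ N * N!`. -/
def creationConst (m : ℝ) (N : ℕ) : ℝ := m ^ N * N.factorial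

lemma creationConst_pos (hm : 0 < m) (N : ℕ) : 0 < creationConst m N := by
  unfold creationConst
  positivity

lemma norm_polyCreation (hm : 0 < m) (N : ℕ) (p : ℂ[X]) :
    ‖polyCreation hm N p‖ = √(creationConst m N) * ‖polyToFock hm p‖ := by
  have h := norm_sq_polyCreation hm N p
  rw [← creationConst] at h
  rw [← Real.sqrt_sq (norm_nonneg (polyCreation hm N p)), h, Real.sqrt_mul
    (creationConst_pos hm N).le, Real.sqrt_sq (norm_nonneg _)]

/-- The canonical solution operator of `∂̄^N u = f` on the Fock space. -/
def solOp (hm : 0 < m) (N : ℕ) : fockSpace m →L[ℂ] L2 m :=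
  (((creationConst m N)⁻¹ : ℂ) • polyCreation hm N).extendOfNorm (polyToFock hm)

lemma norm_smul_polyCreation (hm : 0 < m) (N : ℕ) (p : ℂ[X]) :
    ‖(((creationConst m N)⁻¹ : ℂ) • polyCreation hm N) p‖
      = (√(creationConst m N))⁻¹ * ‖polyToFock hm p‖ := by
  have h := creationConst_pos hm N
  rw [LinearMap.smul_apply, norm_smul, norm_polyCreation, norm_inv, norm_real,
    Real.norm_of_nonneg h.le, ← mul_assoc]
  congr 1
  nth_rewrite 1 [← Real.mul_self_sqrt h.le]
  have := (Real.sqrt_pos.2 h).ne'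
  field_simp

lemma solOp_polyToFock (hm : 0 < m) (N : ℕ) (p : ℂ[X]) :
    solOp hm N (polyToFock hm p) = ((creationConst m N)⁻¹ : ℂ) • polyCreation hm N p :=
  LinearMap.extendOfNorm_eq (denseRange_polyToFock hm)
    ⟨_, fun p => (norm_smul_polyCreation hm N p).le⟩ p

lemma norm_solOp_polyToFock (hm : 0 < m) (N : ℕ) (p : ℂ[X]) :
    ‖solOp hm N (polyToFock hm p)‖ = (√(creationConst m N))⁻¹ * ‖polyToFock hm p‖ := by
  rw [solOp_polyToFock, ← norm_smul_polyCreation]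
  rfl

lemma dbarEq_solOp_polyToFock (hm : 0 < m) (N : ℕ) (p : ℂ[X]) :
    DbarEq N (solOp hm N (polyToFock hm p)) (polyToFock hm p : L2 m) := by
  have hp := hasTemperateGrowth_eval p
  have hD := hasTemperateGrowth_creation_iterate m hp N
  have hs := hasTemperateGrowth_smul ((creationConst m N : ℂ)⁻¹) hD
  have h1 : solOp hm N (polyToFock hm p) = tgL2 hm hs := by
    rw [solOp_polyToFock, tgL2_smul, polyCreation_apply]
  rw [h1]
  refine DbarEq.congr (m := m) (dbarEq_of_contDiff hs.1 N) (coeFn_tgL2 hm hs).symm ?_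
  rw [dbar_iterate_smul _ hD.1, dbar_iterate_creation_iterate m hp.1 (dbar_eval p), smul_smul]
  have h2 : (creationConst m N : ℂ)⁻¹ * ((m : ℂ) ^ N * N.factorial) = 1 := by
    have : (creationConst m N : ℂ) ≠ 0 := by exact_mod_cast (creationConst_pos hm N).ne'
    rw [← inv_mul_cancel₀ this]
    simp [creationConst]
  rw [h2, one_smul]
  exact (coeFn_polyToFock hm p).symm

/-- Against a fixed test function both sides are continuous in `f`, so the identity extends from
polynomials by density. -/
lemma dbarEq_solOp (hm : 0 < m) (N : ℕ) (f : fockSpace m) :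
    DbarEq N (solOp hm N f) (f : L2 m) := by
  intro φ h hc
  obtain ⟨w, hw⟩ := exists_inner_dbar m N h hc
  obtain ⟨w', hw'⟩ := exists_inner_eq m h.continuous hc
  rw [hw, hw']
  refine (denseRange_polyToFock hm).induction_on f ?_ fun p => ?_
  · exact isClosed_eq (continuous_const.inner (solOp hm N).continuous)
      (continuous_const.mul (continuous_const.inner continuous_subtype_val))
  · rw [← hw, ← hw']
    exact dbarEq_solOp_polyToFock hm N p φ h hc

lemma inner_polyCreation_eq_zero (hm : 0 < m) {N : ℕ} (p : ℂ[X]) {u : L2 m}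
    (hu : u ∈ polyFock N m) : inner ℂ (polyCreation hm N p) u = 0 :=
  inner_creation_iterate_polyFock hm hu (hasTemperateGrowth_eval p)

lemma inner_solOp_eq_zero (hm : 0 < m) {N : ℕ} (f : fockSpace m) {u : L2 m}
    (hu : u ∈ polyFock N m) : inner ℂ (solOp hm N f) u = 0 := by
  refine (denseRange_polyToFock hm).induction_on f ?_ fun p => ?_
  · exact isClosed_eq ((solOp hm N).continuous.inner continuous_const) continuous_const
  · rw [solOp_polyToFock, inner_smul_left, inner_polyCreation_eq_zero hm p hu, mul_zero]

lemma sub_mem_polyFock {N : ℕ} {u v : L2 m} {f : ℂ → ℂ} (hu : DbarEq N u f)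
    (hv : DbarEq N v f) : u - v ∈ polyFock N m := by
  intro φ h hc
  obtain ⟨w, hw⟩ := exists_inner_dbar m N h hc
  have h1 := hu φ h hc
  have h2 := hv φ h hc
  rw [hw] at h1 h2 ⊢
  rw [inner_sub_right, h1, h2]
  simp

/-- Any two solutions differ by an element of `polyFock N m`, which is orthogonal to the range of
`solOp`. Pythagoras then yields minimality and uniqueness together. -/
lemma isMinimalSolution_iff (hm : 0 < m) (N : ℕ) (f : fockSpace m) (u : L2 m) :
    IsMinimalSolution N (f : L2 m) u ↔ u = solOp hm N f := by
  have key : ∀ v : L2 m, DbarEq N v (f : L2 m) →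
      ‖v‖ ^ 2 = ‖solOp hm N f‖ ^ 2 + ‖v - solOp hm N f‖ ^ 2 := by
    intro v hv
    have h0 := inner_solOp_eq_zero hm f (sub_mem_polyFock hv (dbarEq_solOp hm N f))
    have h1 := norm_add_sq_eq_norm_sq_add_norm_sq_of_inner_eq_zero _ _ h0
    rw [add_sub_cancel] at h1
    rw [sq, sq, sq, h1]
  constructor
  · rintro ⟨h1, h2⟩
    have h3 := h2 _ (dbarEq_solOp hm N f)
    have h4 := key u h1
    have h5 : ‖u‖ ^ 2 ≤ ‖solOp hm N f‖ ^ 2 := by gcongr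
    have h6 : ‖u - solOp hm N f‖ = 0 := by
      have : ‖u - solOp hm N f‖ ^ 2 ≤ 0 := by linarith
      nlinarith [norm_nonneg (u - solOp hm N f)]
    exact sub_eq_zero.1 (norm_eq_zero.1 h6)
  · rintro rfl
    refine ⟨dbarEq_solOp hm N f, fun v hv => ?_⟩
    have h4 := key v hv
    exact le_of_sq_le_sq (by nlinarith [sq_nonneg ‖v - solOp hm N f‖]) (norm_nonneg _)

/-- An operator which is bounded below on polynomials is not compact. -/
lemma not_isCompactOperator_of_le_norm (hm : 0 < m) (T : fockSpace m →L[ℂ] L2 m) {c : ℝ}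
    (hc : 0 < c) (h : ∀ p, c * ‖polyToFock hm p‖ ≤ ‖T (polyToFock hm p)‖) :
    ¬ IsCompactOperator T := by
  intro hT
  let p : ℕ → ℂ[X] := fun n =>
    ((‖(polyToFock hm (Polynomial.X ^ n) : L2 m)‖⁻¹ : ℝ) : ℂ) • (Polynomial.X ^ n : ℂ[X])
  have hp : ∀ n, (polyToFock hm (p n) : L2 m) = fockBasis hm n := fun n => by
    simp [p, fockBasis]
  have hort := orthonormal_fockBasis hm
  -- Orthonormal vectors are at distance `√2`; the bound `1` suffices.
  have hdist : ∀ i j, i ≠ j → 1 ≤ ‖polyToFock hm (p i - p j)‖ := by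
    intro i j hij
    have h0 : inner ℂ (fockBasis hm i) (-fockBasis hm j) = 0 := by
      rw [inner_neg_right, hort.2 hij, neg_zero]
    have h1 := norm_add_sq_eq_norm_sq_add_norm_sq_of_inner_eq_zero _ _ h0
    rw [norm_neg, hort.1 i, hort.1 j, ← sub_eq_add_neg, ← hp, ← hp] at h1
    have h2 : ‖polyToFock hm (p i - p j)‖
        = ‖(polyToFock hm (p i) : L2 m) - (polyToFock hm (p j) : L2 m)‖ := by
      rw [map_sub]
      rfl
    rw [h2]
    nlinarith [norm_nonneg ((polyToFock hm (p i) : L2 m) - (polyToFock hm (p j) : L2 m))]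
  have hb : Bornology.IsBounded (Set.range fun n => polyToFock hm (p n)) := by
    refine isBounded_iff_forall_norm_le.2 ⟨1, ?_⟩
    rintro _ ⟨n, rfl⟩
    have : ‖polyToFock hm (p n)‖ = ‖fockBasis hm n‖ := by rw [← hp]; rfl
    rw [this, hort.1 n]
  obtain ⟨K, hK, hsub⟩ := IsCompactOperator.image_subset_compact_of_bounded
    (f := (T : fockSpace m →ₗ[ℂ] L2 m)) hT hb
  obtain ⟨a, -, φ, hφ, hlim⟩ := hK.tendsto_subseq
    (x := fun n => T (polyToFock hm (p n))) fun n => hsub ⟨_, ⟨n, rfl⟩, rfl⟩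
  -- Consecutive terms of a convergent subsequence approach each other, yet the lower bound keeps
  -- them at distance at least `c`.
  have hlim' := ((hlim.comp (tendsto_add_atTop_nat 1)).sub hlim).norm
  rw [sub_self, norm_zero] at hlim'
  have hle : c ≤ 0 := ge_of_tendsto hlim' (Eventually.of_forall fun n => by
    have h1 := hdist (φ (n + 1)) (φ n) (hφ (Nat.lt_succ_self n)).ne'
    have h2 := h (p (φ (n + 1)) - p (φ n))
    rw [map_sub, map_sub] at h2
    rw [map_sub] at h1
    exact (le_mul_of_one_le_right hc.le h1).trans h2)
  exact absurd hle hc.not_ge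

lemma not_isCompactOperator_solOp (hm : 0 < m) (N : ℕ) : ¬ IsCompactOperator (solOp hm N) :=
  not_isCompactOperator_of_le_norm hm _ (inv_pos.2 (Real.sqrt_pos.2 (creationConst_pos hm N)))
    fun p => (norm_solOp_polyToFock hm N p).ge

end SolutionOperator

/-! ### Hankel operators: boundedness, compactness, vanishing -/

section Hankel

variable {m : ℝ} {N : ℕ} {g : ℂ → ℂ}

lemma eq_polyToFock (hm : 0 < m) {p : ℂ[X]} {f : fockSpace m}
    (h : (f : L2 m) =ᵐ[μ m] fun z => p.eval z) : f = polyToFock hm p :=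
  Subtype.ext (Lp.ext (h.trans (coeFn_polyToFock hm p).symm))

lemma iterate_derivative_of_degree_le {q : ℂ[X]} (hq : q.degree ≤ (N : WithBot ℕ)) :
    Polynomial.derivative^[N] q = Polynomial.C (N.factorial * q.coeff N) := by
  ext k
  rw [Polynomial.coeff_iterate_derivative, Polynomial.coeff_C]
  split_ifs with h
  · subst h
    simp [Nat.descFactorial_self]
  · rw [Polynomial.coeff_eq_zero_of_degree_lt, smul_zero]
    refine hq.trans_lt ?_
    exact_mod_cast Nat.lt_add_of_pos_left (Nat.pos_of_ne_zero h)

/-- For polynomial symbols of degree at most `N` the Hankel operator is a multiple of the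
canonical solution operator. -/
lemma hankel_of_degree_le (hm : 0 < m) {q : ℂ[X]} (hq : q.degree ≤ (N : WithBot ℕ))
    (hg : ∀ n : ℕ, MemLp (fun z => z ^ n * q.eval z) 2 (μ m)) (p : ℂ[X]) :
    hankel N m (fun z => q.eval z) hg p
      = (N.factorial * conj (q.coeff N) : ℂ) • solOp hm N (polyToFock hm p) := by
  have hp := hasTemperateGrowth_eval p
  have hh : (fun z => conj (q.eval z) * p.eval z).HasTemperateGrowth :=
    (hasTemperateGrowth_conj (hasTemperateGrowth_eval q)).mul hp
  have hD := hasTemperateGrowth_creation_iterate m hp N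
  set c : ℂ := N.factorial * conj (q.coeff N) with hc
  have hs := hasTemperateGrowth_smul (-(c * (creationConst m N : ℂ)⁻¹)) hD
  have ha : c • solOp hm N (polyToFock hm p) = -tgL2 hm hs := by
    rw [solOp_polyToFock, tgL2_smul, polyCreation_apply, smul_smul, neg_smul, neg_neg]
  -- The claimed value is orthogonal to `polyFock N m`, so it is enough that the remainder lies in
  -- the kernel: both terms have the same `∂̄^N`, namely `c p`.
  have hmem : tgL2 hm hh - c • solOp hm N (polyToFock hm p) ∈ polyFock N m := by
    rw [ha, sub_neg_eq_add, ← tgL2_add]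
    refine tgL2_mem_polyFock hm _ ?_
    have h0 : (creationConst m N : ℂ) ≠ 0 := by exact_mod_cast (creationConst_pos hm N).ne'
    have h1 : (fun z => conj (q.eval z) * p.eval z)
        + (-(c * (creationConst m N : ℂ)⁻¹)) • (creation m)^[N] (fun z => p.eval z)
        = (fun z => conj (q.eval z) * p.eval z)
        - (c * (creationConst m N : ℂ)⁻¹) • (creation m)^[N] (fun z => p.eval z) := by
      rw [neg_smul, sub_eq_add_neg]
    have h2 : c * (creationConst m N : ℂ)⁻¹ * ((m : ℂ) ^ N * N.factorial) = c := by
      have : ((m : ℂ) ^ N * N.factorial) = (creationConst m N : ℂ) := by simp [creationConst]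
      rw [this, mul_assoc, inv_mul_cancel₀ h0, mul_one]
    rw [h1, dbar_iterate_sub hh.1 (hasTemperateGrowth_smul _ hD).1, dbar_iterate_smul _ hD.1,
      dbar_iterate_creation_iterate m hp.1 (dbar_eval p), dbar_iterate_conj_mul,
      iterate_derivative_of_degree_le hq, smul_smul, h2]
    ext z
    simp [hc]
  have hproj : (polyFock N m).starProjection (tgL2 hm hh)
      = tgL2 hm hh - c • solOp hm N (polyToFock hm p) := by
    refine Submodule.eq_starProjection_of_mem_of_inner_eq_zero hmem fun w hw => ?_
    rw [sub_sub_cancel, inner_smul_left, inner_solOp_eq_zero hm _ hw, mul_zero]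
  have : hankel N m (fun z => q.eval z) hg p
      = tgL2 hm hh - (polyFock N m).starProjection (tgL2 hm hh) := rfl
  rw [this, hproj, sub_sub_cancel]

/-- The projection drops out because `D^N z^j` is orthogonal to the kernel. By angular weights `g`
may then be replaced by its term of order `N + l`, and for this monomial adjointness moves `∂̄^N`
onto `conj (z^(N+l))`. -/
lemma inner_polyCreation_hankel (hm : 0 < m) (hgd : Differentiable ℂ g)
    (hg : ∀ n : ℕ, MemLp (fun z => z ^ n * g z) 2 (μ m)) (j l : ℕ) :
    inner ℂ (polyCreation hm N (Polynomial.X ^ j)) (hankel N m g hg (Polynomial.X ^ (j + l)))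
      = conj (taylorCoeff g (N + l)) * ((N + l).descFactorial N : ℂ)
        * ((‖polyToFock hm (Polynomial.X ^ (j + l))‖ ^ 2 : ℝ) : ℂ) := by
  have hX : ∀ n, (fun z : ℂ => (Polynomial.X ^ n : ℂ[X]).eval z) = fun z => z ^ n := fun n => by
    simp
  have hpow : ∀ n, (fun z : ℂ => z ^ n).HasTemperateGrowth := fun n =>
    (HasTemperateGrowth.id' (E := ℂ)).pow n
  have hpow' : ∀ n, (fun z : ℂ => conj (z ^ n)).HasTemperateGrowth := fun n =>
    hasTemperateGrowth_conj (hpow n)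
  have hw := hasTemperateGrowth_creation_iterate m (hpow j) N
  set w := (creation m)^[N] (fun z : ℂ => z ^ j) with hwdef
  have hwL : polyCreation hm N (Polynomial.X ^ j) = tgL2 hm hw :=
    tgL2_congr hm (hasTemperateGrowth_creation_iterate m
      (hasTemperateGrowth_eval (Polynomial.X ^ j)) N) hw (by rw [hX])
  have hmono : (fun z : ℂ => conj (z ^ (N + l)) * z ^ (j + l)).HasTemperateGrowth :=
    (hpow' _).mul (hpow _)
  have hgm := memLp_conj_mul_poly hg (Polynomial.X ^ (j + l))
  have e1 : inner ℂ (tgL2 hm hw) (hankel N m g hg (Polynomial.X ^ (j + l)))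
      = ∫ z, conj (w z) * (conj (g z) * z ^ (j + l)) ∂(μ m) := by
    rw [hankel, inner_sub_right, ← hwL,
      inner_polyCreation_eq_zero hm _ (Submodule.starProjection_apply_mem _ _), sub_zero, hwL,
      tgL2, inner_toLp]
    refine integral_congr_ae ?_
    filter_upwards [hgm.coeFn_toLp] with z hz
    rw [hz]
    simp
  -- Conjugating puts the entire function `g` itself, not `ḡ`, under the integral.
  have e2 : ∫ z, conj (w z) * (conj (g z) * z ^ (j + l)) ∂(μ m)
      = conj (∫ z, w z * conj (z ^ (j + l)) * g z ∂(μ m)) := by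
    rw [← integral_conj]
    congr 1
    ext z
    simp only [map_mul, conj_conj]
    ring
  have e3 : conj (∫ z, w z * conj (z ^ (j + l)) * z ^ (N + l) ∂(μ m))
      = inner ℂ (tgL2 hm hw) (tgL2 hm hmono) := by
    rw [inner_tgL2_tgL2, ← integral_conj]
    congr 1
    ext z
    simp only [map_mul, conj_conj]
    ring
  have hmono' : (fun z : ℂ => conj ((N + l).descFactorial N * z ^ l) * z ^ (j + l)).HasTemperateGrowth :=
    (hasTemperateGrowth_conj ((HasTemperateGrowth.const _).mul (hpow l))).mul (hpow _)
  have e4 : inner ℂ (tgL2 hm hw) (tgL2 hm hmono)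
      = inner ℂ (tgL2 hm (hpow j)) (tgL2 hm hmono') := by
    refine inner_creation_iterate_tgL2 hm (hpow j) hmono hmono' ?_
    have h := dbar_iterate_conj_mul (Polynomial.X ^ (N + l)) (Polynomial.X ^ (j + l)) N
    rw [Polynomial.iterate_derivative_X_pow_eq_natCast_mul] at h
    simpa using! h
  have e5 : inner ℂ (tgL2 hm (hpow j)) (tgL2 hm hmono')
      = (N + l).descFactorial N * inner ℂ (tgL2 hm (hpow (j + l))) (tgL2 hm (hpow (j + l))) := by
    rw [inner_tgL2_tgL2, inner_tgL2_tgL2, ← integral_const_mul]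
    congr 1
    ext z
    simp only [map_mul, map_pow, map_natCast]
    ring
  have e6 : tgL2 hm (hpow (j + l)) = (polyToFock hm (Polynomial.X ^ (j + l)) : L2 m) :=
    tgL2_congr hm (hpow _) (hasTemperateGrowth_eval _) (hX _).symm
  have hi : Integrable (fun z => w z * conj (z ^ (j + l)) * g z) (μ m) := by
    have h := (conjCLE : ℂ →L[ℝ] ℂ).integrable_comp
      (integrable_conj_mul (memLp_of_hasTemperateGrowth hm hw) hgm)
    refine h.congr (Eventually.of_forall fun z => ?_)
    simp
    ring
  have hi' : Integrable (fun z => w z * conj (z ^ (j + l)) * z ^ (N + l)) (μ m) := by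
    have h := (conjCLE : ℂ →L[ℝ] ℂ).integrable_comp
      (integrable_conj_mul (memLp_of_hasTemperateGrowth hm hw)
        (memLp_of_hasTemperateGrowth hm hmono))
    refine h.congr (Eventually.of_forall fun z => ?_)
    simp
    ring
  -- The weight of `D^N z^j` is `j - N` and that of `conj (z^(j+l))` is `-(j + l)`; together they
  -- give `-(N + l)`.
  have hrot : ∀ ζ z : ℂ, ‖ζ‖ = 1 →
      w (ζ * z) * conj ((ζ * z) ^ (j + l)) * ζ ^ (N + l) = w z * conj (z ^ (j + l)) := by
    intro ζ z hζ
    have h1 := creation_iterate_rotation m (hpow j).1 hζ (c := ζ ^ j)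
      (fun z => mul_pow ζ z j) N z
    have h2 : conj ζ * ζ = 1 := by rw [conj_mul', hζ]; simp
    have h3 : conj ζ ^ N * ζ ^ j * conj ζ ^ (j + l) * ζ ^ (N + l) = 1 := by
      calc _ = (conj ζ * ζ) ^ (N + j + l) := by ring
        _ = 1 := by rw [h2, one_pow]
    rw [hwdef, h1, mul_pow, map_mul, map_pow conj ζ]
    linear_combination ((creation m)^[N] (fun z : ℂ => z ^ j) z * conj (z ^ (j + l))) * h3
  rw [hwL, e1, e2, integral_mul_entire hgd
    (Φ := fun z => w z * conj (z ^ (j + l))) (hw.1.continuous.mul (hpow' _).1.continuous) hrot hi hi',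
    map_mul, e3, e4, e5, e6, inner_self_eq_norm_sq_to_K, mul_assoc, ofReal_pow]
  rfl

/-- A nonzero coefficient would force `‖z^(j+l)‖ / ‖z^j‖` to stay bounded in `j`, although its
square is `(j+l)! / (j! m^l)`. -/
lemma taylorCoeff_eq_zero_of_extends (hm : 0 < m) (hgd : Differentiable ℂ g)
    (hg : ∀ n : ℕ, MemLp (fun z => z ^ n * g z) 2 (μ m)) {T : fockSpace m →L[ℂ] L2 m}
    (hT : Extends T (hankel N m g hg)) {l : ℕ} (hl : 0 < l) : taylorCoeff g (N + l) = 0 := by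
  by_contra hne
  set A : ℝ := ‖taylorCoeff g (N + l)‖ * ((N + l).descFactorial N : ℝ) with hA
  have hApos : 0 < A := by
    have : 0 < (N + l).descFactorial N := Nat.descFactorial_pos.2 (Nat.le_add_right N l)
    positivity
  set B : ℝ := creationConst m N * ‖T‖ ^ 2 * m ^ l with hB
  have key : ∀ j : ℕ, A ^ 2 * (j + 1) ≤ B := by
    intro j
    set x := ‖polyToFock hm (Polynomial.X ^ (j + l))‖ with hx
    set y := ‖polyToFock hm (Polynomial.X ^ j)‖ with hy
    have hxpos : 0 < x := norm_X_pow_pos hm _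
    have h1 : A * x ^ 2 ≤ (√(creationConst m N) * y) * (‖T‖ * x) := by
      have h := congrArg norm (inner_polyCreation_hankel (N := N) hm hgd hg j l)
      rw [norm_mul, norm_mul, RCLike.norm_conj, norm_natCast, norm_real,
        Real.norm_of_nonneg (sq_nonneg _)] at h
      rw [hA, ← h]
      refine (norm_inner_le_norm _ _).trans ?_
      rw [norm_polyCreation, ← hT _ (polyToFock hm (Polynomial.X ^ (j + l)))
        (coeFn_polyToFock hm _)]
      gcongr
      exact T.le_opNorm _
    have h2 : A * x ≤ √(creationConst m N) * y * ‖T‖ := by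
      refine le_of_mul_le_mul_right ?_ hxpos
      linarith
    have h3 : A ^ 2 * x ^ 2 ≤ creationConst m N * ‖T‖ ^ 2 * y ^ 2 := by
      have h4 : (A * x) ^ 2 ≤ (√(creationConst m N) * y * ‖T‖) ^ 2 := by gcongr
      calc A ^ 2 * x ^ 2 = (A * x) ^ 2 := by ring
        _ ≤ (√(creationConst m N) * y * ‖T‖) ^ 2 := h4
        _ = √(creationConst m N) ^ 2 * ‖T‖ ^ 2 * y ^ 2 := by ring
        _ = _ := by rw [Real.sq_sqrt (creationConst_pos hm N).le]
    have hx2 : x ^ 2 = (j + l).factorial / m ^ (j + l + 1) := norm_sq_X_pow hm _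
    have hy2 : y ^ 2 = j.factorial / m ^ (j + 1) := norm_sq_X_pow hm _
    -- Since `l ≥ 1`, the quotient `(j+l)!/j!` is at least `j + 1`; linear growth already
    -- contradicts the bound `B`.
    have hfac : ((j : ℝ) + 1) * j.factorial ≤ (j + l).factorial := by
      have h5 : (j + 1).factorial ≤ (j + l).factorial := Nat.factorial_le (by omega)
      rw [Nat.factorial_succ] at h5
      exact_mod_cast h5
    rw [hx2, hy2, show j + l + 1 = (j + 1) + l by ring, pow_add, mul_div_assoc', mul_div_assoc',
      div_le_div_iff₀ (by positivity) (by positivity)] at h3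
    have h6 : A ^ 2 * ((j : ℝ) + 1) * (j.factorial * m ^ (j + 1))
        ≤ B * (j.factorial * m ^ (j + 1)) := by
      calc A ^ 2 * ((j : ℝ) + 1) * (j.factorial * m ^ (j + 1))
          = A ^ 2 * (((j : ℝ) + 1) * j.factorial) * m ^ (j + 1) := by ring
        _ ≤ A ^ 2 * (j + l).factorial * m ^ (j + 1) := by gcongr
        _ ≤ _ := h3
        _ = _ := by rw [hB]; ring
    exact le_of_mul_le_mul_right h6 (by positivity)
  obtain ⟨j, hj⟩ := exists_nat_gt (B / A ^ 2)
  rw [div_lt_iff₀ (by positivity)] at hj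
  nlinarith [key j, sq_nonneg A]

lemma eq_eval_of_taylorCoeff_eq_zero (hgd : Differentiable ℂ g)
    (h : ∀ l, 0 < l → taylorCoeff g (N + l) = 0) :
    ∃ q : ℂ[X], q.degree ≤ (N : WithBot ℕ) ∧ g = fun z => q.eval z := by
  refine ⟨∑ n ∈ Finset.range (N + 1), Polynomial.C (taylorCoeff g n) * Polynomial.X ^ n, ?_, ?_⟩
  · refine (Polynomial.degree_sum_le _ _).trans (Finset.sup_le fun n hn => ?_)
    refine (Polynomial.degree_C_mul_X_pow_le _ _).trans ?_
    exact_mod_cast Nat.lt_succ_iff.1 (Finset.mem_range.1 hn)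
  · ext z
    have h1 := hasSum_sum_of_ne_finset_zero (L := .unconditional ℕ) (f := fun n => taylorCoeff g n * z ^ n)
      (s := Finset.range (N + 1)) fun n hn => by
        obtain ⟨l, rfl⟩ := Nat.exists_eq_add_of_le (not_lt.1 (Finset.mem_range.not.1 hn))
        rw [add_assoc, h _ (by omega), zero_mul]
    rw [(hasSum_taylorCoeff hgd z).unique h1, Polynomial.eval_finsetSum]
    simp

lemma extends_smul_solOp (hm : 0 < m) {q : ℂ[X]} (hq : q.degree ≤ (N : WithBot ℕ))
    (hg : ∀ n : ℕ, MemLp (fun z => z ^ n * q.eval z) 2 (μ m)) :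
    Extends ((N.factorial * conj (q.coeff N) : ℂ) • solOp hm N)
      (hankel N m (fun z => q.eval z) hg) := by
  intro p f hf
  rw [hankel_of_degree_le hm hq, eq_polyToFock hm hf]
  rfl

lemma exists_extends_iff (hm : 0 < m) (hgd : Differentiable ℂ g)
    (hg : ∀ n : ℕ, MemLp (fun z => z ^ n * g z) 2 (μ m)) :
    (∃ T : fockSpace m →L[ℂ] L2 m, Extends T (hankel N m g hg)) ↔
      ∃ q : ℂ[X], q.degree ≤ (N : WithBot ℕ) ∧ g = fun z => q.eval z := by
  constructor
  · rintro ⟨T, hT⟩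
    exact eq_eval_of_taylorCoeff_eq_zero hgd fun l hl =>
      taylorCoeff_eq_zero_of_extends hm hgd hg hT hl
  · rintro ⟨q, hq, rfl⟩
    exact ⟨_, extends_smul_solOp hm hq hg⟩

lemma hankel_eq_zero_of_degree_lt (hm : 0 < m) {q : ℂ[X]} (hq : q.degree < (N : WithBot ℕ))
    (hg : ∀ n : ℕ, MemLp (fun z => z ^ n * q.eval z) 2 (μ m)) (p : ℂ[X]) :
    hankel N m (fun z => q.eval z) hg p = 0 := by
  rw [hankel_of_degree_le hm hq.le, Polynomial.coeff_eq_zero_of_degree_lt hq]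
  simp

/-- If the degree is exactly `N`, any extension agrees on polynomials with a nonzero multiple of
`solOp`, so it is bounded below there and cannot be compact. -/
lemma exists_extends_compact_iff (hm : 0 < m) (hgd : Differentiable ℂ g)
    (hg : ∀ n : ℕ, MemLp (fun z => z ^ n * g z) 2 (μ m)) :
    (∃ T : fockSpace m →L[ℂ] L2 m, Extends T (hankel N m g hg) ∧ IsCompactOperator T) ↔
      ∃ q : ℂ[X], q.degree < (N : WithBot ℕ) ∧ g = fun z => q.eval z := by
  constructor
  · rintro ⟨T, hT, hTc⟩
    obtain ⟨q, hq, rfl⟩ := (exists_extends_iff hm hgd hg).1 ⟨T, hT⟩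
    refine ⟨q, ?_, rfl⟩
    by_contra hlt
    have hdeg : q.degree = (N : WithBot ℕ) := le_antisymm hq (not_lt.1 hlt)
    have hc : (N.factorial * conj (q.coeff N) : ℂ) ≠ 0 := by
      refine mul_ne_zero (by exact_mod_cast N.factorial_ne_zero) ?_
      rw [Ne, map_eq_zero]
      exact Polynomial.coeff_ne_zero_of_eq_degree hdeg
    refine not_isCompactOperator_of_le_norm hm T (c := ‖(N.factorial * conj (q.coeff N) : ℂ)‖ *
      (√(creationConst m N))⁻¹) (mul_pos (norm_pos_iff.2 hc)
        (inv_pos.2 (Real.sqrt_pos.2 (creationConst_pos hm N)))) (fun p => ?_) hTc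
    rw [hT p _ (coeFn_polyToFock hm p), hankel_of_degree_le hm hq, norm_smul,
      norm_solOp_polyToFock, mul_assoc]
  · rintro ⟨q, hq, rfl⟩
    refine ⟨0, fun p f _ => ?_, isCompactOperator_zero⟩
    rw [hankel_eq_zero_of_degree_lt hm hq]
    rfl

/-- If the operator vanishes, the zero map is a compact extension, and the compactness criterion
gives the degree bound. -/
lemma hankel_eq_zero_iff (hm : 0 < m) (hgd : Differentiable ℂ g)
    (hg : ∀ n : ℕ, MemLp (fun z => z ^ n * g z) 2 (μ m)) :
    (∃ q : ℂ[X], q.degree < (N : WithBot ℕ) ∧ g = fun z => q.eval z) ↔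
      ∀ p : ℂ[X], hankel N m g hg p = 0 := by
  constructor
  · rintro ⟨q, hq, rfl⟩ p
    exact hankel_eq_zero_of_degree_lt hm hq hg p
  · intro h
    exact (exists_extends_compact_iff hm hgd hg).1
      ⟨0, fun p f _ => (h p).symm, isCompactOperator_zero⟩

end Hankel

end Fock

end

theorem theorem1 (m : ℝ) (hm : 0 < m) (N : ℕ) :
    (∀ (g : ℂ → ℂ) (_ : Differentiable ℂ g)
        (hg : ∀ n : ℕ, MemLp (fun z => z ^ n * g z) 2 (Fock.μ m)),
      ((∃ T : Fock.fockSpace m →L[ℂ] Fock.L2 m, Fock.Extends T (Fock.hankel N m g hg)) ↔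
        ∃ q : ℂ[X], q.degree ≤ (N : WithBot ℕ) ∧ g = fun z => q.eval z) ∧
      ((∃ T : Fock.fockSpace m →L[ℂ] Fock.L2 m, Fock.Extends T (Fock.hankel N m g hg) ∧
          IsCompactOperator T) ↔
        ∃ q : ℂ[X], q.degree < (N : WithBot ℕ) ∧ g = fun z => q.eval z) ∧
      ((∃ q : ℂ[X], q.degree < (N : WithBot ℕ) ∧ g = fun z => q.eval z) ↔
        ∀ p : ℂ[X], Fock.hankel N m g hg p = 0)) ∧
    (∃ S : Fock.fockSpace m →L[ℂ] Fock.L2 m,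
      (∀ (f : Fock.fockSpace m) (u : Fock.L2 m),
        Fock.IsMinimalSolution N (f : Fock.L2 m) u ↔ u = S f) ∧
      ¬ IsCompactOperator S) := by
  refine ⟨fun g hgd hg => ⟨Fock.exists_extends_iff hm hgd hg,
    Fock.exists_extends_compact_iff hm hgd hg, Fock.hankel_eq_zero_iff hm hgd hg⟩,
    Fock.solOp hm N, Fock.isMinimalSolution_iff hm N, Fock.not_isCompactOperator_solOp hm N⟩
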